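/- Let $m,n\in\mathbb{N}$, $d_0=\min\{m,n\}$, and let $\mathbb{R}^{m\times n}$ carry the Frobenius inner product; $\|\cdot\|_F,\|\cdot\|_{\mathrm{op}},\|\cdot\|_*$ are the Frobenius, operator and nuclear norms. Let $f:\mathbb{R}^{m\times n}\to\mathbb{R}$ be differentiable, bounded below by $f_\star\in\mathbb{R}$, and $L$-smooth, i.e. $\|\nabla f(X)-\nabla f(Y)\|_F\le L\|X-Y\|_F$ for all $X,Y$ (hence also $f(Y)\le f(X)+\langle\nabla f(X),Y-X\rangle+\frac L2\|X-Y\|_F^2$). Fix $K\ge1$, $\eta>0$, $\beta\in(0,1)$, $B\in\mathbb{N}$ and deterministic $X_0,C_{-1}\in\mathbb{R}^{m\times n}$ (typically $C_{-1}=0$). Muon with Nesterov momentum runs, for $k\ge 0$, $$G_k=\frac1B\sum_{i=1}^BG_k^i,\quad C_k=\beta C_{k-1}+G_k,\quad M_k=\beta C_k+G_k,\quad X_{k+1}=X_k-\eta\,\mathcal{T}(M_k),$$ where $G_k^1,\dots,G_k^B$ are random matrices and $\mathcal{T}(M_k)=\mathcal{T}_k(M_k;\zeta_k)$ is a measurable,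 possibly randomized map with internal seed $\zeta_k$. Let $(\mathcal{F}_k)$ be a filtration such that $G_k^i$ and $\zeta_k$ are $\mathcal{F}_{k+1}$-measurable, and let $\zeta_k$ be independent of $\mathcal{F}_k\vee\sigma(G_k^1,\dots,G_k^B)$. Assume for $0\le k\le K-1$: * (heavy-tailed noise) given $\mathcal{F}_k$, the samples $G_k^1,\dots,G_k^B$ are independent, $\mathbb{E}[G_k^i\mid\mathcal{F}_k]=\nabla f(X_k)$ and $\mathbb{E}[\|G_k^i-\nabla f(X_k)\|_F^\alpha\mid\mathcal{F}_k]\le\sigma_0^\alpha+\sigma_1^\alpha\|\nabla f(X_k)\|_F^\alpha$, with $\alpha\in(1,2]$ and $\sigma_0,\sigma_1\ge0$; * (inexact polar step) there are constants $\gamma_k\in[0,1)$, $\nu_k\ge0$ with $\mathbb{E}[\langle M_k,\mathcal{T}(M_k)\rangle\mid M_k]\ge(1-\gamma_k)\|M_k\|_*$ and $\mathbb{E}[\|\mathcal{T}(M_k)\|_{\mathrm{op}}^2\mid M_k]\le(1+\nu_k)^2$. Put $\bar\gamma=\max_{0\le k\le K-1}\gamma_k$, $\bar\nu=\max_{0\le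 k\le K-1}\nu_k$ and $S_0=(1-\beta)M_0-\nabla f(X_0)$. Then there are a constant $\mathcal{C}_\alpha\in(0,2]$ depending only on $\alpha$ and a constant $A>0$ depending only on $\alpha$ and $d_0$ such that, whenever $$B>\left(\frac{2\sqrt\pi\,(1+\sqrt{d_0}(1+\bar\nu))\,\mathcal{C}_\alpha^{1/\alpha}\sigma_1}{1-\bar\gamma}\right)^{\frac{\alpha}{\alpha-1}},$$ one has $$\rho:=1-\bar\gamma-\frac{(1+\sqrt{d_0}(1+\bar\nu))\,2\sqrt\pi\,\mathcal{C}_\alpha^{1/\alpha}\sigma_1}{B^{(\alpha-1)/\alpha}}>0,$$ the variables $\|\nabla f(X_k)\|_F$ $(0\le k\le K-1)$ and $\|S_0\|_F$ are integrable, and $$\min_{0\le k\le K-1}\mathbb{E}\|\nabla f(X_k)\|_F\le A\Big(\frac{f(X_0)-f_\star}{\rho\eta K}+\frac{\beta^2L(1+\bar\nu)^2\eta}{\rho(1-\beta)}+\frac{(1+\bar\nu)\sigma_0(1-\beta)^{\frac{\alpha-1}\alpha}}{\rho B^{\frac{\alpha-1}\alpha}}+\frac{L\eta(1+\bar\nu)^2}{\rho}+\frac{(1+\bar\nu)\mathbb{E}\|S_0\|_F}{\rho(1-\beta)K}+\frac{(1+\bar\nu)\sigma_1\|\nabla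 f(X_0)\|_F}{\rho B^{\frac{\alpha-1}\alpha}K}\Big).$$ In particular, if $K\ge2$, $\eta=K^{-\frac{2\alpha-1}{3\alpha-2}}$ and $1-\beta=K^{-\frac{\alpha}{3\alpha-2}}$, then the minimum is $O\big(K^{-\frac{\alpha-1}{3\alpha-2}}\big)$; precisely, $$\min_{0\le k\le K-1}\mathbb{E}\|\nabla f(X_k)\|_F\le\frac A\rho\Big(f(X_0)-f_\star+(1+\bar\nu)^2L+(1+\bar\nu)\big(\sigma_0+(1+\sigma_1)\|\nabla f(X_0)\|_F+\|C_{-1}\|_F\big)\Big)K^{-\frac{\alpha-1}{3\alpha-2}}.$$ -/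

import Mathlib

open MeasureTheory ProbabilityTheory
open scoped Gradient InnerProductSpace

namespace Muon

/-- The space `ℝ^{m × n}` with the Frobenius inner product `⟪X, Y⟫ = ∑ X i j * Y i j`;
its norm is the Frobenius norm. -/
abbrev Mat (m n : ℕ) : Type := EuclideanSpace ℝ (Fin m × Fin n)

variable {m n : ℕ}

/-- The entries of `X`, as a Mathlib matrix. -/
def Mat.toMatrix (X : Mat m n) : Matrix (Fin m) (Fin n) ℝ :=
  Matrix.of fun i j => X (i, j)

/-- The linear map `ℝⁿ → ℝᵐ`, `v ↦ X v`, between Euclidean spaces. -/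
noncomputable def Mat.toLin (X : Mat m n) :
    EuclideanSpace ℝ (Fin n) →ₗ[ℝ] EuclideanSpace ℝ (Fin m) :=
  Matrix.toEuclideanLin X.toMatrix

/-- Operator (spectral) norm of a matrix. -/
noncomputable def opNorm (X : Mat m n) : ℝ :=
  ‖LinearMap.toContinuousLinearMap X.toLin‖

/-- Nuclear norm of a matrix: the sum of its singular values (Mathlib's sequence of singular
values of a linear map on `ℝⁿ` vanishes from index `n` on). -/
noncomputable def nuclearNorm (X : Mat m n) : ℝ :=
  ∑ i ∈ Finset.range n, X.toLin.singularValues i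

theorem norm_sq_eq (X : Mat m n) : ‖X‖ ^ 2 = ∑ i, ∑ j, X.toMatrix i j ^ 2 := by
  rw [EuclideanSpace.norm_sq_eq, Fintype.sum_prod_type]
  simp [Mat.toMatrix]

theorem inner_eq (X Y : Mat m n) :
    ⟪X, Y⟫_ℝ = ∑ i, ∑ j, X.toMatrix i j * Y.toMatrix i j := by
  rw [PiLp.inner_apply, Fintype.sum_prod_type]
  simp [Mat.toMatrix, mul_comm]

/-- `f` is `L`-smooth: differentiable with `L`-Lipschitz gradient in the Frobenius norm. -/
structure LSmooth (f : Mat m n → ℝ) (L : ℝ) : Prop where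
  differentiable : Differentiable ℝ f
  gradient_lipschitz : ∀ X Y, ‖∇ f X - ∇ f Y‖ ≤ L * ‖X - Y‖

section Algorithm

variable {Ω Z : Type*} {B : ℕ}

/-- The mini-batch gradient estimate `G_k = (1/B) ∑ᵢ G_kⁱ`. -/
noncomputable def batchGrad (G : ℕ → Fin B → Ω → Mat m n) (k : ℕ) (ω : Ω) : Mat m n :=
  (1 / (B : ℝ)) • ∑ i, G k i ω

/-- Momentum `C_k = β C_{k-1} + G_k`, started from `C_{-1} = Cinit`. -/
noncomputable def momentum (β : ℝ) (Cinit : Mat m n) (G : ℕ → Fin B → Ω → Mat m n) :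
    ℕ → Ω → Mat m n
  | 0, ω => β • Cinit + batchGrad G 0 ω
  | k + 1, ω => β • momentum β Cinit G k ω + batchGrad G (k + 1) ω

/-- Nesterov momentum `M_k = β C_k + G_k`. -/
noncomputable def nesterov (β : ℝ) (Cinit : Mat m n) (G : ℕ → Fin B → Ω → Mat m n)
    (k : ℕ) (ω : Ω) : Mat m n :=
  β • momentum β Cinit G k ω + batchGrad G k ω

/-- The computed direction `𝒯(M_k)`: the (possibly randomized) routine `T k` is run on the
momentum matrix `M_k` with its internal random seed `ζ k`. -/
noncomputable def polarStep (β : ℝ) (Cinit : Mat m n) (G : ℕ → Fin B → Ω → Mat m n)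
    (T : ℕ → Mat m n → Z → Mat m n) (ζ : ℕ → Ω → Z) (k : ℕ) (ω : Ω) : Mat m n :=
  T k (nesterov β Cinit G k ω) (ζ k ω)

/-- The iterates `X_{k+1} = X_k - η 𝒯(M_k)`. -/
noncomputable def iterate (η β : ℝ) (X₀ Cinit : Mat m n) (G : ℕ → Fin B → Ω → Mat m n)
    (T : ℕ → Mat m n → Z → Mat m n) (ζ : ℕ → Ω → Z) : ℕ → Ω → Mat m n
  | 0, _ => X₀
  | k + 1, ω => iterate η β X₀ Cinit G T ζ k ω - η • polarStep β Cinit G T ζ k ω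

/-- The initial momentum error `S_0 = (1 - β) M_0 - ∇f(X_0)`. -/
noncomputable def initialError (β : ℝ) (f : Mat m n → ℝ) (X₀ Cinit : Mat m n)
    (G : ℕ → Fin B → Ω → Mat m n) (ω : Ω) : Mat m n :=
  (1 - β) • nesterov β Cinit G 0 ω - ∇ f X₀

end Algorithm

section Assumptions

variable {Ω Z : Type*} [mΩ : MeasurableSpace Ω] [MeasurableSpace Z] {B : ℕ}

/-- Conditional independence of a finite family of random matrices given a `σ`-algebra `m'`:
conditional probabilities of joint events factor almost surely. -/
def CondIndepFamily (μ : Measure Ω) (m' : MeasurableSpace Ω) (Y : Fin B → Ω → Mat m n) : Prop :=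
  ∀ A : Fin B → Set (Mat m n), (∀ i, MeasurableSet (A i)) →
    μ[(⋂ i, Y i ⁻¹' A i).indicator (fun _ => (1 : ℝ)) | m'] =ᵐ[μ]
      ∏ i, μ[(Y i ⁻¹' A i).indicator (fun _ => (1 : ℝ)) | m']

/-- `ℱ k` contains all randomness used before iteration `k`: the gradient samples and the seeds
of iteration `k` are known at the beginning of iteration `k + 1`. -/
structure Adapted (ℱ : Filtration ℕ mΩ) (K : ℕ) (G : ℕ → Fin B → Ω → Mat m n)
    (ζ : ℕ → Ω → Z) : Prop where
  grad : ∀ k < K, ∀ i, Measurable[ℱ (k + 1)] (G k i)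
  seed : ∀ k < K, Measurable[ℱ (k + 1)] (ζ k)

/-- Generalized heavy-tailed noise. Along the iterates `X`, given `ℱ k` the samples
`G_k¹, …, G_kᴮ` are conditionally independent and unbiased, with conditional central
`α`-th moment at most `σ₀^α + σ₁^α ‖∇f(X_k)‖^α`. -/
structure HeavyTailedNoise (μ : Measure Ω) (ℱ : Filtration ℕ mΩ) (K : ℕ) (f : Mat m n → ℝ)
    (X : ℕ → Ω → Mat m n) (G : ℕ → Fin B → Ω → Mat m n) (α σ₀ σ₁ : ℝ) : Prop where
  integrable : ∀ k < K, ∀ i, Integrable (G k i) μ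
  integrable_moment : ∀ k < K, ∀ i, Integrable (fun ω => ‖G k i ω - ∇ f (X k ω)‖ ^ α) μ
  condIndep : ∀ k < K, CondIndepFamily μ (ℱ k) (G k)
  unbiased : ∀ k < K, ∀ i, μ[G k i | ℱ k] =ᵐ[μ] fun ω => ∇ f (X k ω)
  moment : ∀ k < K, ∀ i, ∀ᵐ ω ∂μ,
    (μ[fun ω' => ‖G k i ω' - ∇ f (X k ω')‖ ^ α | ℱ k]) ω
      ≤ σ₀ ^ α + σ₁ ^ α * ‖∇ f (X k ω)‖ ^ α

/-- The seeds are fresh: `ζ k` is independent of everything that happened until `M_k` was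
formed, that is, of the past `ℱ k` together with the gradient samples of iteration `k`. -/
def FreshSeeds (μ : Measure Ω) (ℱ : Filtration ℕ mΩ) (K : ℕ) (G : ℕ → Fin B → Ω → Mat m n)
    (ζ : ℕ → Ω → Z) : Prop :=
  ∀ k < K, Indep (MeasurableSpace.comap (ζ k) inferInstance)
    (ℱ k ⊔ ⨆ i, MeasurableSpace.comap (G k i) inferInstance) μ

/-- The inexact polar condition: with `M k` the momentum matrices and `D k = 𝒯(M k)` the computed
directions, `E[⟪M_k, D_k⟫ | M_k] ≥ (1 - γ_k) ‖M_k‖_*` and `E[‖D_k‖_op² | M_k] ≤ (1 + ν_k)²`. -/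
structure InexactPolar (μ : Measure Ω) (K : ℕ) (M D : ℕ → Ω → Mat m n) (γ ν : ℕ → ℝ) :
    Prop where
  gamma_nonneg : ∀ k < K, 0 ≤ γ k
  gamma_lt_one : ∀ k < K, γ k < 1
  nu_nonneg : ∀ k < K, 0 ≤ ν k
  integrable_inner : ∀ k < K, Integrable (fun ω => ⟪M k ω, D k ω⟫_ℝ) μ
  integrable_opNorm : ∀ k < K, Integrable (fun ω => opNorm (D k ω) ^ 2) μ
  alignment : ∀ k < K, ∀ᵐ ω ∂μ, (1 - γ k) * nuclearNorm (M k ω) ≤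
    (μ[fun ω' => ⟪M k ω', D k ω'⟫_ℝ | MeasurableSpace.comap (M k) inferInstance]) ω
  feasibility : ∀ k < K, ∀ᵐ ω ∂μ,
    (μ[fun ω' => opNorm (D k ω') ^ 2 | MeasurableSpace.comap (M k) inferInstance]) ω
      ≤ (1 + ν k) ^ 2

end Assumptions

/-- `maxUpTo K a = max_{0 ≤ k ≤ K-1} a_k` (for `K ≥ 1`). -/
noncomputable def maxUpTo (K : ℕ) (a : ℕ → ℝ) : ℝ := ⨆ k : Fin K, a k

/-- `minUpTo K a = min_{0 ≤ k ≤ K-1} a_k` (for `K ≥ 1`). -/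
noncomputable def minUpTo (K : ℕ) (a : ℕ → ℝ) : ℝ := ⨅ k : Fin K, a k

/-- The batch-size threshold
`(2 √π (1 + √d₀ (1 + ν̄)) 𝒞^{1/α} σ₁ / (1 - γ̄))^{α/(α-1)}`. -/
noncomputable def batchThreshold (α Cα : ℝ) (d₀ : ℕ) (σ₁ γbar νbar : ℝ) : ℝ :=
  (2 * √Real.pi * (1 + √(d₀ : ℝ) * (1 + νbar)) * Cα ^ (1 / α) * σ₁ / (1 - γbar))
    ^ (α / (α - 1))

/-- `ρ = 1 - γ̄ - (1 + √d₀ (1 + ν̄)) 2 √π 𝒞^{1/α} σ₁ / B^{(α-1)/α}`. -/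
noncomputable def rho (α Cα : ℝ) (d₀ : ℕ) (σ₁ γbar νbar : ℝ) (B : ℕ) : ℝ :=
  1 - γbar - (1 + √(d₀ : ℝ) * (1 + νbar)) * (2 * √Real.pi) * Cα ^ (1 / α) * σ₁
    / (B : ℝ) ^ ((α - 1) / α)

end Muon

/-!
The proof combines a descent inequality with a bound for the momentum error
`S_k = (1 - β) M_k - ∇f(X_k)`, in expectation and with first moments of the gradients only.

*Descent.* Write `D_k = 𝒯(M_k)`. Since `∇f(X_k) = (1 - β) M_k - S_k` and
`𝔼⟪M_k, D_k⟫ ≥ (1 - γ) 𝔼‖M_k‖_* ≥ (1 - γ) 𝔼‖M_k‖`, one step lowers `𝔼 f` by at least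
`η ((1 - γ) 𝔼‖∇f(X_k)‖ - (1 + √d₀ (1 + ν)) 𝔼‖S_k‖)`, up to a term of order `L η² d₀ (1 + ν)²`
(`MuonRun.integral_descent`). The product `‖S_k‖ ‖D_k‖` splits because `S_k` is known when `M_k` is
formed, whereas `D_k` depends on it only through `M_k` and a fresh seed, so that the second moment
bound given `M_k` holds given the whole past (`integral_mul_norm_le`).

*Momentum error.* `S_k` is `β ^ k S_0`, plus a drift of order `L η / (1 - β)` from the moving
gradient, plus a weighted sum `∑_j a_{kj} ξ_j` of the batch noises `ξ_j = G_j - ∇f(X_j)`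
(`momentumError_succ`, `noiseWeight`).

*Noise.* The gradients are only known to be integrable, so the conditional `α`-th moments of the
noise cannot be integrated. Instead the batches are peeled off one at a time from
`𝔼(‖∑_j a_j ξ_j‖ ^ α + r) ^ (1 / α)`. The inequality
`‖y + x‖ ^ α ≤ ‖y‖ ^ α + α ⟪‖y‖ ^ (α - 2) y, x⟫ + 2 ‖x‖ ^ α` (`norm_add_rpow_le`) together with
orthogonality of each centered sample to all earlier ones
(`CondIndepFamily.integral_inner_eq_zero`) adds
`s ^ α + u ^ α` inside the root, where `s` is a constant multiple of `σ₀` and `u` a multiple of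
`‖∇f(X_j)‖`, and subadditivity of the root moves `u` outside (`CondIndepFamily.integral_root_step`).
The result (`HeavyTailedNoise.integral_norm_sum_le`) is
`𝔼‖∑_j a_j ξ_j‖ ≤ c (σ₀ (∑_j |a_j| ^ α) ^ (1 / α) + σ₁ ∑_j |a_j| 𝔼‖∇f(X_j)‖)` with
`c = 2 ^ (1 / α) / B ^ ((α - 1) / α)`.

*Conclusion.* Summed over `k`, each `𝔼‖∇f(X_j)‖` receives the total weight `2 c σ₁`
(`sum_sum_noiseWeight_le`), hence with the factor `1 + √d₀ (1 + ν)` at most what separates `ρ` from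
`1 - γ` when `𝒞_α = 2`. These terms are absorbed on the left, which leaves
`ρ ∑_k 𝔼‖∇f(X_k)‖` there (`MuonRun.minUpTo_le`). For the prescribed `η` and `β`, each remaining
term is of order `K ^ (-(α - 1) / (3 α - 2))` (`error_terms_le_rate`). The sixth term of the bound
is not needed: the noise of iteration `0` is contained in `S_0`.
-/

namespace Muon

/-! ### Pointwise inequalities for real powers of norms -/

/-- The graph of the concave function `z ↦ z ^ p` lies below its tangent at `w`. -/
theorem rpow_le_tangent {p z w : ℝ} (hp₀ : 0 ≤ p) (hp₁ : p ≤ 1) (hz : 0 ≤ z) (hw : 0 < w) :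
    z ^ p ≤ w ^ p + p * w ^ (p - 1) * (z - w) := by
  have h := rpow_one_add_le_one_add_mul_self (s := z / w - 1)
    (by linarith [div_nonneg hz hw.le]) hp₀ hp₁
  have h1 : 1 + (z / w - 1) = z / w := by ring
  rw [h1, Real.div_rpow hz hw.le, div_le_iff₀ (Real.rpow_pos_of_pos hw p)] at h
  have h2 : w ^ p = w ^ (p - 1) * w := by
    rw [← Real.rpow_add_one hw.ne']; congr 1; ring
  calc z ^ p ≤ _ := h
    _ = w ^ p + p * (z / w - 1) * (w ^ (p - 1) * w) := by rw [← h2]; ring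
    _ = w ^ p + p * w ^ (p - 1) * (z - w) := by
      field_simp

/-- Subadditivity of `z ↦ z ^ (1 / α)`, with the root of the second summand taken out. -/
theorem rpow_add_rpow_root_le {α a c u : ℝ} (hα : 1 < α) (ha : 0 ≤ a) (hc : 0 ≤ c) (hu : 0 ≤ u) :
    (a + c * u ^ α) ^ (1 / α) ≤ a ^ (1 / α) + c ^ (1 / α) * u := by
  have h0 : 0 < α := by linarith
  have h := Real.rpow_add_le_add_rpow ha (mul_nonneg hc (Real.rpow_nonneg hu α))
    (p := 1 / α) (by positivity) (by rw [div_le_one h0]; linarith)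
  rwa [Real.mul_rpow hc (Real.rpow_nonneg hu α), ← Real.rpow_mul hu, mul_one_div_cancel h0.ne',
    Real.rpow_one] at h

section Hilbert

variable {E : Type*} [NormedAddCommGroup E] [InnerProductSpace ℝ E]

/-- For `1 < α ≤ 2` the function `‖·‖ ^ α` stays within `2 ‖x‖ ^ α` of its linearization. Where `x`
is the shorter vector this is concavity of `z ↦ z ^ (α / 2)` at `‖y‖ ^ 2`, where it is the longer
one concavity at `‖x‖ ^ 2`. -/
theorem norm_add_rpow_le {α : ℝ} (hα₁ : 1 < α) (hα₂ : α ≤ 2) (y x : E) :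
    ‖y + x‖ ^ α ≤ ‖y‖ ^ α + α * ⟪‖y‖ ^ (α - 2) • y, x⟫_ℝ + 2 * ‖x‖ ^ α := by
  rw [real_inner_smul_left]
  have habs := abs_le.1 (abs_real_inner_le_norm y x)
  have hsq := norm_add_sq_real y x
  set s := ‖y‖ with hs
  set t := ‖x‖ with ht
  set c := ⟪y, x⟫_ℝ with hc
  have hs0 : 0 ≤ s := norm_nonneg y
  have ht0 : 0 ≤ t := norm_nonneg x
  have key : ∀ w : ℝ, 0 < w → ‖y + x‖ ^ α ≤
      w ^ α + α / 2 * w ^ (α - 2) * (s ^ 2 + 2 * c + t ^ 2 - w ^ 2) := by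
    intro w hw
    have h := rpow_le_tangent (p := α / 2) (by linarith) (by linarith)
      (sq_nonneg ‖y + x‖) (pow_pos hw 2)
    have e : ∀ z : ℝ, 0 ≤ z → ∀ q : ℝ, (z ^ 2) ^ q = z ^ (2 * q) := fun z hz q => by
      rw [← Real.rpow_natCast, ← Real.rpow_mul hz]; norm_num
    rw [e _ (norm_nonneg _), e _ hw.le, e _ hw.le, hsq] at h
    convert h using 2 <;> ring_nf
  have pow_split : ∀ w : ℝ, 0 < w → w ^ α = w ^ (α - 2) * w ^ 2 := fun w hw => by
    rw [← Real.rpow_natCast, ← Real.rpow_add hw]; norm_num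
  rcases hs0.eq_or_lt with h0 | hspos
  · have hy : y = 0 := norm_eq_zero.1 h0.symm
    have : c = 0 := by rw [hc, hy, inner_zero_left]
    rw [this, hy, zero_add, ← ht]
    have := Real.rpow_nonneg ht0 α
    have := Real.rpow_nonneg hs0 α
    linarith
  rcases le_or_gt t s with hts | hts
  · have h := key s hspos
    have h2 : s ^ (α - 2) * t ^ 2 ≤ t ^ α := by
      rcases ht0.eq_or_lt with h0 | htpos
      · rw [← h0, Real.zero_rpow (by linarith)]; simp
      · rw [pow_split t htpos]
        exact mul_le_mul_of_nonneg_right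
          (Real.rpow_le_rpow_of_nonpos htpos hts (by linarith)) (by positivity)
    have h3 := Real.rpow_nonneg ht0 α
    nlinarith
  · have htpos : 0 < t := hspos.trans hts
    have h := key t htpos
    have hab : t ^ (α - 2) ≤ s ^ (α - 2) :=
      Real.rpow_le_rpow_of_nonpos hspos hts.le (by linarith)
    have hb : 0 ≤ t ^ (α - 2) := Real.rpow_nonneg ht0 _
    -- Young's inequality bounds the cross term `s ^ (α - 1) * t`
    have hY : α * (s ^ (α - 2) * s * t) ≤ (α - 1) * s ^ α + t ^ α := by
      have h4 := Real.geom_mean_le_arith_mean2_weighted (w₁ := (α - 1) / α) (w₂ := 1 / α)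
        (p₁ := s ^ α) (p₂ := t ^ α) (by apply div_nonneg <;> linarith) (by positivity)
        (by positivity) (by positivity) (by field_simp; ring)
      rw [← Real.rpow_mul hs0, ← Real.rpow_mul ht0] at h4
      have e1 : α * ((α - 1) / α) = α - 2 + 1 := by field_simp; ring
      have e2 : α * (1 / α) = 1 := by field_simp
      rw [e1, e2, Real.rpow_one, Real.rpow_add_one hspos.ne'] at h4
      have h5 := mul_le_mul_of_nonneg_left h4 (by linarith : 0 ≤ α)
      have e3 : α * ((α - 1) / α * s ^ α + 1 / α * t ^ α) = (α - 1) * s ^ α + t ^ α := by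
        field_simp
      rwa [e3] at h5
    have h6 : 0 ≤ (s ^ (α - 2) - t ^ (α - 2)) * (c + s * t) :=
      mul_nonneg (by linarith) (by linarith)
    have h7 : t ^ (α - 2) * s ^ 2 ≤ t ^ (α - 2) * (s * t) :=
      mul_le_mul_of_nonneg_left (by nlinarith) hb
    have h8 : (α - 1) * s ^ α ≤ s ^ α := by
      have := Real.rpow_nonneg hs0 α
      nlinarith
    have h9 : 0 ≤ α * (t ^ (α - 2) * (s * t)) := by positivity
    have h10 := mul_nonneg (by linarith : 0 ≤ α) h6
    have h11 := mul_le_mul_of_nonneg_left h7 (by linarith : 0 ≤ α / 2)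
    linear_combination h + hY + h10 + h11 + h8 + h9 / 2

/-- Iterating `norm_add_rpow_le` along the partial sums of a finite family. -/
theorem norm_add_sum_rpow_le {α : ℝ} (hα₁ : 1 < α) (hα₂ : α ≤ 2) (y : E) (x : ℕ → E) (n : ℕ) :
    ‖y + ∑ i ∈ Finset.range n, x i‖ ^ α ≤ ‖y‖ ^ α
      + α * ∑ l ∈ Finset.range n, ⟪‖y + ∑ i ∈ Finset.range l, x i‖ ^ (α - 2) •
          (y + ∑ i ∈ Finset.range l, x i), x l⟫_ℝ
      + 2 * ∑ l ∈ Finset.range n, ‖x l‖ ^ α := by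
  induction n with
  | zero => simp
  | succ n ih =>
    have h := norm_add_rpow_le hα₁ hα₂ (y + ∑ i ∈ Finset.range n, x i) (x n)
    rw [Finset.sum_range_succ, ← add_assoc, Finset.sum_range_succ, Finset.sum_range_succ]
    linarith

/-- Quadratic upper bound of an `L`-smooth function. The mean value inequality gives the constant
`L` in place of the sharp `L / 2`, which only affects absolute constants. -/
theorem le_add_inner_gradient_add [CompleteSpace E] {f : E → ℝ} {L : ℝ} (hL : 0 ≤ L)
    (hf : Differentiable ℝ f) (hlip : ∀ X Y, ‖∇ f X - ∇ f Y‖ ≤ L * ‖X - Y‖) (X Y : E) :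
    f Y ≤ f X + ⟪∇ f X, Y - X⟫_ℝ + L * ‖Y - X‖ ^ 2 := by
  have hb : ∀ z ∈ segment ℝ X Y, ‖fderiv ℝ f z - fderiv ℝ f X‖ ≤ L * ‖Y - X‖ := by
    intro z hz
    have e : ∀ w, fderiv ℝ f w = InnerProductSpace.toDual ℝ E (∇ f w) := fun w => by
      simp [gradient]
    rw [e, e, ← map_sub, LinearIsometryEquiv.norm_map]
    refine (hlip z X).trans (mul_le_mul_of_nonneg_left ?_ hL)
    exact norm_sub_le_of_mem_segment hz
  have h := (convex_segment X Y).norm_image_sub_le_of_norm_fderiv_le'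
    (fun z _ => hf z) hb (left_mem_segment ℝ X Y) (right_mem_segment ℝ X Y)
  rw [← inner_gradient_left, Real.norm_eq_abs] at h
  have := (abs_le.1 h).2
  nlinarith

end Hilbert

/-! ### Comparison of the matrix norms -/

section Norms

variable {m n : ℕ}

theorem toLin_apply (X : Mat m n) (v : EuclideanSpace ℝ (Fin n)) (i : Fin m) :
    X.toLin v i = ∑ j, X (i, j) * v j := by
  simp [Mat.toLin, Mat.toMatrix, Matrix.mulVec, dotProduct]

theorem toLin_single (X : Mat m n) (i : Fin m) (j : Fin n) :
    X.toLin (EuclideanSpace.single j 1) i = X (i, j) := by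
  simp [toLin_apply]

theorem norm_sq_eq_sum_columns (X : Mat m n) :
    ‖X‖ ^ 2 = ∑ j, ‖X.toLin (EuclideanSpace.single j 1)‖ ^ 2 := by
  rw [norm_sq_eq, Finset.sum_comm]
  refine Finset.sum_congr rfl fun j _ => ?_
  rw [EuclideanSpace.norm_sq_eq]
  simp [toLin_single, Mat.toMatrix]

theorem norm_sq_eq_sum_singularValues (X : Mat m n) :
    ‖X‖ ^ 2 = ∑ i ∈ Finset.range n, X.toLin.singularValues i ^ 2 := by
  have hn : Module.finrank ℝ (EuclideanSpace ℝ (Fin n)) = n := by simp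
  rw [Finset.sum_range]
  simp_rw [X.toLin.sq_singularValues_fin hn]
  have h := (X.toLin.isSymmetric_adjoint_comp_self).trace_eq_sum_eigenvalues hn
  rw [LinearMap.trace_eq_sum_inner _ (EuclideanSpace.basisFun (Fin n) ℝ)] at h
  simp only [RCLike.ofReal_real_eq_id, id] at h
  rw [← h, norm_sq_eq_sum_columns]
  refine Finset.sum_congr rfl fun j _ => ?_
  rw [LinearMap.comp_apply, LinearMap.adjoint_inner_right, real_inner_self_eq_norm_sq,
    EuclideanSpace.basisFun_apply]

theorem nuclearNorm_nonneg (X : Mat m n) : 0 ≤ nuclearNorm X :=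
  Finset.sum_nonneg fun _ _ => X.toLin.singularValues_nonneg _

theorem norm_le_nuclearNorm (X : Mat m n) : ‖X‖ ≤ nuclearNorm X := by
  refine le_of_sq_le_sq ?_ (nuclearNorm_nonneg X)
  rw [norm_sq_eq_sum_singularValues]
  exact Finset.sum_sq_le_sq_sum_of_nonneg fun _ _ => X.toLin.singularValues_nonneg _

theorem norm_toLin_le (X : Mat m n) (v : EuclideanSpace ℝ (Fin n)) :
    ‖X.toLin v‖ ≤ opNorm X * ‖v‖ :=
  (LinearMap.toContinuousLinearMap X.toLin).le_opNorm v

theorem opNorm_nonneg (X : Mat m n) : 0 ≤ opNorm X := norm_nonneg _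

/-- `‖X‖_F ≤ √d₀ ‖X‖_op`: all rows and all columns have length at most `‖X‖_op`. -/
theorem norm_le_sqrt_mul_opNorm (X : Mat m n) :
    ‖X‖ ≤ √((min m n : ℕ) : ℝ) * opNorm X := by
  have hcol : ‖X‖ ^ 2 ≤ n * opNorm X ^ 2 := by
    rw [norm_sq_eq_sum_columns]
    calc _ ≤ ∑ _j : Fin n, opNorm X ^ 2 := Finset.sum_le_sum fun j _ => by
          have h := norm_toLin_le X (EuclideanSpace.single j 1)
          rw [PiLp.norm_single, norm_one, mul_one] at h
          exact pow_le_pow_left₀ (norm_nonneg _) h 2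
      _ = _ := by simp
  have hrow : ‖X‖ ^ 2 ≤ m * opNorm X ^ 2 := by
    rw [norm_sq_eq]
    calc _ ≤ ∑ _i : Fin m, opNorm X ^ 2 := Finset.sum_le_sum fun i _ => by
          set r : EuclideanSpace ℝ (Fin n) := WithLp.toLp 2 fun j => X (i, j) with hr
          have e : ∑ j, X.toMatrix i j ^ 2 = ‖r‖ ^ 2 := by
            rw [EuclideanSpace.norm_sq_eq]; simp [hr, Mat.toMatrix]
          rw [e]
          have h1 : X.toLin r i = ‖r‖ ^ 2 := by
            rw [← e, toLin_apply]
            refine Finset.sum_congr rfl fun j _ => ?_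
            simp [hr, Mat.toMatrix, sq]
          have h2 : X.toLin r i ≤ opNorm X * ‖r‖ :=
            (le_abs_self _).trans (((X.toLin r).norm_apply_le i).trans (norm_toLin_le X r))
          rw [h1] at h2
          refine pow_le_pow_left₀ (norm_nonneg _) ?_ 2
          rcases (norm_nonneg r).eq_or_lt with h0 | h0
          · rw [← h0]; exact opNorm_nonneg X
          · nlinarith
      _ = _ := by simp
  refine le_of_sq_le_sq ?_ (mul_nonneg (Real.sqrt_nonneg _) (opNorm_nonneg X))
  rw [mul_pow, Real.sq_sqrt (Nat.cast_nonneg _)]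
  rcases min_choice m n with h | h <;> rw [h] <;> assumption

theorem continuous_opNorm : Continuous (opNorm : Mat m n → ℝ) := by
  have h : Continuous fun X : Mat m n => LinearMap.toContinuousLinearMap X.toLin := by
    let φ : Mat m n →ₗ[ℝ] (EuclideanSpace ℝ (Fin n) →L[ℝ] EuclideanSpace ℝ (Fin m)) :=
      { toFun := fun X => LinearMap.toContinuousLinearMap X.toLin
        map_add' := fun X Y => by
          ext v i
          simp [toLin_apply, add_mul, Finset.sum_add_distrib]
        map_smul' := fun c X => by
          ext v i
          simp [toLin_apply, Finset.mul_sum, mul_assoc] }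
    exact φ.continuous_of_finiteDimensional
  exact h.norm

end Norms

/-! ### Conditionally independent samples -/

section Conditional

variable {Ω : Type*} {m m₂ : MeasurableSpace Ω} [mΩ : MeasurableSpace Ω] {μ : Measure Ω}
  {E : Type*} [NormedAddCommGroup E] [NormedSpace ℝ E]

/-- Two integrable functions with equal integrals on a π-system containing the whole space have
equal integrals on the generated `σ`-algebra. -/
theorem setIntegral_eq_of_isPiSystem {f g : Ω → E} (hf : Integrable f μ) (hg : Integrable g μ)
    (hm : m ≤ mΩ) {C : Set (Set Ω)}
    (hC : m = MeasurableSpace.generateFrom C) (hpi : IsPiSystem C) (huniv : Set.univ ∈ C)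
    (h : ∀ t ∈ C, ∫ ω in t, f ω ∂μ = ∫ ω in t, g ω ∂μ) :
    ∀ t, MeasurableSet[m] t → ∫ ω in t, f ω ∂μ = ∫ ω in t, g ω ∂μ := by
  have hall : ∫ ω, f ω ∂μ = ∫ ω, g ω ∂μ := by simpa using h _ huniv
  refine MeasurableSpace.induction_on_inter (C := fun t _ => ∫ ω in t, f ω ∂μ = ∫ ω in t, g ω ∂μ)
    hC hpi (by simp) h ?_ ?_
  · intro t ht ih
    have e1 := integral_add_compl (hm t ht) hf
    have e2 := integral_add_compl (hm t ht) hg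
    rw [← hall, ← e1, ih] at e2
    exact (add_left_cancel e2).symm
  · intro s hd hs ih
    rw [integral_iUnion (fun i => hm _ (hs i)) hd hf.integrableOn,
      integral_iUnion (fun i => hm _ (hs i)) hd hg.integrableOn]
    exact tsum_congr ih

theorem setIntegral_eq_integral_smul {t : Set Ω} (ht : MeasurableSet t) (q : Ω → E) :
    ∫ ω in t, q ω ∂μ = ∫ ω, t.indicator (fun _ => (1 : ℝ)) ω • q ω ∂μ := by
  rw [← integral_indicator ht]
  refine integral_congr_ae (ae_of_all _ fun ω => ?_)
  by_cases hω : ω ∈ t <;> simp [hω]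

variable [IsProbabilityMeasure μ] [CompleteSpace E]

/-- Conditional expectation is self-adjoint, for a bounded scalar against an integrable vector. -/
theorem integral_condExp_smul_comm (hm : m ≤ mΩ) {a : Ω → ℝ} {R : ℝ}
    (ha : Integrable a μ) (hR : ∀ᵐ ω ∂μ, |a ω| ≤ R) {q : Ω → E} (hq : Integrable q μ) :
    ∫ ω, (μ[a | m]) ω • q ω ∂μ = ∫ ω, a ω • (μ[q | m]) ω ∂μ := by
  have hR' : ∀ᵐ ω ∂μ, ‖(μ[a | m]) ω‖ ≤ R := ae_bdd_abs_condExp_of_ae_bdd_abs hR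
  have h1 : Integrable (μ[a | m] • q) μ :=
    hq.bdd_smul _ integrable_condExp.aestronglyMeasurable hR'
  have h2 : Integrable (a • μ[q | m]) μ :=
    integrable_condExp.bdd_smul _ ha.aestronglyMeasurable hR
  have e1 := condExp_smul_of_aestronglyMeasurable_left
    (stronglyMeasurable_condExp (m := m) (f := a) (μ := μ)).aestronglyMeasurable h1 hq
  have e2 := condExp_smul_of_aestronglyMeasurable_right ha h2
    (stronglyMeasurable_condExp (m := m) (f := q) (μ := μ)).aestronglyMeasurable
  have i1 := integral_condExp (μ := μ) hm (f := μ[a | m] • q)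
  have i2 := integral_condExp (μ := μ) hm (f := a • μ[q | m])
  rw [integral_congr_ae e1] at i1
  rw [integral_congr_ae e2] at i2
  exact i1.symm.trans i2

/-- If the conditional probabilities of the events `Q ∈ A` do not change when `m` is enlarged to
`m₂`, then neither does the conditional expectation of `Q`. -/
theorem setIntegral_condExp_of_indicator [MeasurableSpace E] [BorelSpace E]
    [SecondCountableTopology E] (hm : m ≤ mΩ) (hm₂ : m₂ ≤ mΩ)
    {Q : Ω → E} (hQm : Measurable Q) (hQ : Integrable Q μ)
    (h : ∀ A, MeasurableSet A → ∀ t, MeasurableSet[m₂] t →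
      ∫ ω in t, (Q ⁻¹' A).indicator (fun _ => (1 : ℝ)) ω ∂μ
        = ∫ ω in t, (μ[(Q ⁻¹' A).indicator (fun _ => (1 : ℝ)) | m]) ω ∂μ)
    {t : Set Ω} (ht : MeasurableSet[m₂] t) :
    ∫ ω in t, Q ω ∂μ = ∫ ω in t, (μ[Q | m]) ω ∂μ := by
  have ht' := hm₂ t ht
  set a : Ω → ℝ := t.indicator (fun _ => (1 : ℝ)) with ha
  have hai : Integrable a μ := (integrable_const _).indicator ht'
  have hab : ∀ᵐ ω ∂μ, |a ω| ≤ (1 : ℝ) := ae_of_all _ fun ω => by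
    by_cases hω : ω ∈ t <;> simp [ha, hω]
  set w : Ω → ℝ := μ[a | m] with hw
  have hwm : Measurable w := (stronglyMeasurable_condExp.mono hm).measurable
  have hw0 : 0 ≤ᵐ[μ] w := condExp_nonneg (ae_of_all _ fun ω => by
    by_cases hω : ω ∈ t <;> simp [ha, hω])
  have hwd : Measurable fun ω => ENNReal.ofReal (w ω) := hwm.ennreal_ofReal
  -- the law of `Q` on `t` is its law under the density `w`
  have hlaw : (μ.restrict t).map Q = (μ.withDensity fun ω => ENNReal.ofReal (w ω)).map Q := by
    ext A hA
    have hQA := hQm hA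
    rw [Measure.map_apply hQm hA, Measure.map_apply hQm hA, withDensity_apply _ hQA,
      ← ofReal_integral_eq_lintegral_ofReal integrable_condExp.integrableOn
        (ae_restrict_of_ae hw0), ← ENNReal.ofReal_toReal (measure_ne_top (μ.restrict t) _)]
    congr 1
    have h1 := h A hA t ht
    have h2 := integral_condExp_smul_comm hm hai hab
      ((integrable_const (1 : ℝ)).indicator hQA (μ := μ))
    rw [setIntegral_eq_integral_smul ht' (μ[_ | m]), ← h2] at h1
    rw [integral_indicator hQA] at h1
    simp only [integral_const, smul_eq_mul, mul_one] at h1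
    rw [Measure.real, Measure.restrict_apply_univ, Measure.restrict_apply hQA] at *
    rw [h1, ← integral_indicator hQA]
    refine integral_congr_ae (ae_of_all _ fun ω => ?_)
    by_cases hω : ω ∈ Q ⁻¹' A
    · simp [Set.indicator_of_mem hω]
    · simp [Set.indicator_of_notMem hω]
  have e1 : ∫ ω in t, Q ω ∂μ = ∫ x, x ∂((μ.restrict t).map Q) :=
    (integral_map hQm.aemeasurable aestronglyMeasurable_id).symm
  have e2 : ∫ x, x ∂((μ.withDensity fun ω => ENNReal.ofReal (w ω)).map Q) = ∫ ω, w ω • Q ω ∂μ := by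
    rw [integral_map (f := fun x : E => x) hQm.aemeasurable aestronglyMeasurable_id,
      integral_withDensity_eq_integral_toReal_smul hwd (ae_of_all _ fun _ => ENNReal.ofReal_lt_top)]
    refine integral_congr_ae ?_
    filter_upwards [hw0] with ω hω
    rw [ENNReal.toReal_ofReal hω]
  rw [e1, hlaw, e2, integral_condExp_smul_comm hm hai hab hQ, setIntegral_eq_integral_smul ht']

end Conditional

section Samples

variable {m n : ℕ} {Ω : Type*} {B : ℕ}

/-- The information in `p` together with the samples of index less than `l`. -/
abbrev samplesBefore (p : MeasurableSpace Ω) (G : Fin B → Ω → Mat m n) (l : ℕ) :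
    MeasurableSpace Ω :=
  p ⊔ ⨆ i : Fin B, ⨆ _ : (i : ℕ) < l, MeasurableSpace.comap (G i) inferInstance

theorem measurable_samplesBefore (p : MeasurableSpace Ω) (G : Fin B → Ω → Mat m n) {l : ℕ}
    {i : Fin B} (hi : (i : ℕ) < l) : Measurable[samplesBefore p G l] (G i) := by
  rw [measurable_iff_comap_le]
  refine le_sup_of_le_right ?_
  exact le_iSup₂_of_le (f := fun (i : Fin B) (_ : (i : ℕ) < l) =>
    MeasurableSpace.comap (G i) inferInstance) i hi le_rfl

/-- Generators of `samplesBefore p G l`. -/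
def samplesBeforeGen (p : MeasurableSpace Ω) (G : Fin B → Ω → Mat m n) (l : ℕ) : Set (Set Ω) :=
  {t | ∃ F, MeasurableSet[p] F ∧ ∃ A : Fin B → Set (Mat m n), (∀ i, MeasurableSet (A i)) ∧
    (∀ i : Fin B, l ≤ i → A i = Set.univ) ∧ t = F ∩ ⋂ i, G i ⁻¹' A i}

theorem isPiSystem_samplesBeforeGen (p : MeasurableSpace Ω) (G : Fin B → Ω → Mat m n) (l : ℕ) :
    IsPiSystem (samplesBeforeGen p G l) := by
  rintro _ ⟨F, hF, A, hA, hAl, rfl⟩ _ ⟨F', hF', A', hA', hAl', rfl⟩ -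
  refine ⟨F ∩ F', hF.inter hF', fun i => A i ∩ A' i, fun i => (hA i).inter (hA' i),
    fun i hi => by simp [hAl i hi, hAl' i hi], ?_⟩
  simp only [Set.preimage_inter, Set.iInter_inter_distrib]
  exact Set.inter_inter_inter_comm _ _ _ _

theorem univ_mem_samplesBeforeGen (p : MeasurableSpace Ω) (G : Fin B → Ω → Mat m n) (l : ℕ) :
    Set.univ ∈ samplesBeforeGen p G l :=
  ⟨Set.univ, .univ, fun _ => Set.univ, fun _ => .univ, fun _ _ => rfl, by simp⟩

theorem samplesBefore_eq_generateFrom (p : MeasurableSpace Ω) (G : Fin B → Ω → Mat m n) (l : ℕ) :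
    samplesBefore p G l = MeasurableSpace.generateFrom (samplesBeforeGen p G l) := by
  refine le_antisymm (sup_le ?_ (iSup₂_le fun i hi => ?_)) (MeasurableSpace.generateFrom_le ?_)
  · intro F hF
    exact MeasurableSpace.measurableSet_generateFrom
      ⟨F, hF, fun _ => Set.univ, fun _ => .univ, fun _ _ => rfl, by simp⟩
  · rintro _ ⟨A, hA, rfl⟩
    refine MeasurableSpace.measurableSet_generateFrom
      ⟨Set.univ, .univ, fun j => if j = i then A else Set.univ, fun j => ?_, fun j hj => ?_, ?_⟩
    · dsimp only; split_ifs
      exacts [hA, .univ]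
    · have : j ≠ i := by rintro rfl; omega
      simp [this]
    · ext ω
      simp only [Set.mem_preimage, Set.univ_inter, Set.mem_iInter]
      constructor
      · intro h j
        split_ifs with hj
        · rw [hj]; exact h
        · trivial
      · intro h
        simpa using h i
  · rintro _ ⟨F, hF, A, hA, hAl, rfl⟩
    refine MeasurableSet.inter ((le_sup_left : p ≤ samplesBefore p G l) F hF) ?_
    refine MeasurableSet.iInter fun i => ?_
    rcases lt_or_ge (i : ℕ) l with hi | hi
    · exact measurable_samplesBefore p G hi (hA i)
    · rw [hAl i hi]; exact .univ

variable {p : MeasurableSpace Ω} [mΩ : MeasurableSpace Ω] {μ : Measure Ω}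

theorem samplesBefore_le (hp : p ≤ mΩ) {G : Fin B → Ω → Mat m n}
    (hG : ∀ i, Measurable (G i)) (l : ℕ) : samplesBefore p G l ≤ mΩ :=
  sup_le hp (iSup_le fun i => iSup_le fun _ => (hG i).comap_le)

variable [IsProbabilityMeasure μ]

/-- Given `p`, the sample `l` has the same conditional probabilities when the earlier samples are
revealed. -/
theorem CondIndepFamily.setIntegral_indicator (hp : p ≤ mΩ)
    {G : Fin B → Ω → Mat m n} (hGm : ∀ i, Measurable (G i)) (hG : CondIndepFamily μ p G)
    (l : Fin B) {A : Set (Mat m n)} (hA : MeasurableSet A) {t : Set Ω}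
    (ht : MeasurableSet[samplesBefore p G l] t) :
    ∫ ω in t, (G l ⁻¹' A).indicator (fun _ => (1 : ℝ)) ω ∂μ
      = ∫ ω in t, (μ[(G l ⁻¹' A).indicator (fun _ => (1 : ℝ)) | p]) ω ∂μ := by
  have hI : ∀ {S : Set Ω}, MeasurableSet S → Integrable (S.indicator fun _ => (1 : ℝ)) μ :=
    fun hS => (integrable_const _).indicator hS
  have hI1 : ∀ (S : Set Ω), ∀ᵐ ω ∂μ, |S.indicator (fun _ => (1 : ℝ)) ω| ≤ (1 : ℝ) :=
    fun S => ae_of_all _ fun ω => by by_cases hω : ω ∈ S <;> simp [hω]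
  refine setIntegral_eq_of_isPiSystem (hI (hGm l hA)) integrable_condExp
    (samplesBefore_le hp hGm l) (samplesBefore_eq_generateFrom p G l)
    (isPiSystem_samplesBeforeGen p G l) (univ_mem_samplesBeforeGen p G l) ?_ t ht
  rintro _ ⟨F, hF, D, hD, hDl, rfl⟩
  set S := ⋂ i, G i ⁻¹' D i with hS
  have hSm : MeasurableSet S := MeasurableSet.iInter fun i => hGm i (hD i)
  set a : Ω → ℝ := S.indicator fun _ => (1 : ℝ) with ha
  set q : Ω → ℝ := (G l ⁻¹' A).indicator fun _ => (1 : ℝ) with hq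
  -- the conditional probability of `S ∩ {G l ∈ A}` factors
  have hfac : μ[a * q | p] =ᵐ[μ] μ[a | p] * μ[q | p] := by
    have h1 := hG (Function.update D l A) (fun i => by
      rcases eq_or_ne i l with rfl | hi
      · simpa using hA
      · simpa [hi] using hD i)
    have h2 := hG D hD
    have hDu : D l = Set.univ := hDl l le_rfl
    have hset : (⋂ i, G i ⁻¹' (Function.update D l A) i) = S ∩ G l ⁻¹' A := by
      ext ω
      simp only [hS, Set.mem_iInter, Set.mem_preimage, Set.mem_inter_iff]
      constructor
      · intro h
        refine ⟨fun i => ?_, by simpa using h l⟩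
        rcases eq_or_ne i l with rfl | hi
        · rw [hDu]; trivial
        · simpa [hi] using h i
      · rintro ⟨h, h'⟩ i
        rcases eq_or_ne i l with rfl | hi
        · simpa using h'
        · simpa [hi] using h i
    have haq : (S ∩ G l ⁻¹' A).indicator (fun _ => (1 : ℝ)) = a * q := by
      ext ω
      by_cases h1 : ω ∈ S <;> by_cases h2 : ω ∈ G l ⁻¹' A <;>
        simp [ha, hq, h1, h2]
    have hone : μ[(G l ⁻¹' D l).indicator (fun _ => (1 : ℝ)) | p] = fun _ => (1 : ℝ) := by
      rw [hDu, Set.preimage_univ, Set.indicator_univ, condExp_const hp]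
    rw [hset, haq, ← Finset.mul_prod_erase _ _ (Finset.mem_univ l), Function.update_self] at h1
    rw [← Finset.mul_prod_erase _ _ (Finset.mem_univ l), hone] at h2
    have hprod : ∏ i ∈ Finset.univ.erase l,
        μ[(G i ⁻¹' (Function.update D l A) i).indicator (fun _ => (1 : ℝ)) | p]
        = ∏ i ∈ Finset.univ.erase l, μ[(G i ⁻¹' D i).indicator (fun _ => (1 : ℝ)) | p] :=
      Finset.prod_congr rfl fun i hi => by rw [Function.update_of_ne (Finset.ne_of_mem_erase hi)]
    rw [hprod] at h1
    filter_upwards [h1, h2] with ω e1 e2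
    rw [e1, Pi.mul_apply, Pi.mul_apply, e2, Pi.mul_apply, one_mul, mul_comm]
  have hai : Integrable a μ := hI hSm
  have hqi : Integrable q μ := hI (hGm l hA)
  have haq : Integrable (a * q) μ := hqi.bdd_mul hai.aestronglyMeasurable (hI1 S)
  have haq' : Integrable (a * μ[q | p]) μ :=
    integrable_condExp.bdd_mul hai.aestronglyMeasurable (hI1 S)
  have hr : ∀ g : Ω → ℝ, ∫ ω in F ∩ S, g ω ∂μ = ∫ ω in F, (a * g) ω ∂μ := by
    intro g
    rw [Set.inter_comm, ← Measure.restrict_restrict hSm, ← integral_indicator hSm]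
    refine integral_congr_ae (ae_of_all _ fun ω => ?_)
    by_cases hω : ω ∈ S <;> simp [ha, hω]
  rw [hr, hr, ← setIntegral_condExp hp haq hF, ← setIntegral_condExp hp haq' hF]
  refine setIntegral_congr_ae (hp F hF) ?_
  filter_upwards [hfac, condExp_mul_of_aestronglyMeasurable_right
    (stronglyMeasurable_condExp (m := p) (f := q) (μ := μ)).aestronglyMeasurable haq' hai]
    with ω e1 e2 _
  rw [e1, e2]

/-- A centered sample is orthogonal to everything determined by the past and the earlier samples
of the same batch. -/
theorem CondIndepFamily.integral_inner_eq_zero (hp : p ≤ mΩ)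
    {G : Fin B → Ω → Mat m n} (hGm : ∀ i, Measurable (G i)) (hG : CondIndepFamily μ p G)
    (l : Fin B) (hGi : Integrable (G l) μ) {g : Ω → Mat m n} (hg : μ[G l | p] =ᵐ[μ] g)
    {H : Ω → Mat m n} (hH : Measurable[samplesBefore p G l] H)
    (hHi : Integrable (fun ω => ⟪H ω, G l ω - g ω⟫_ℝ) μ) :
    ∫ ω, ⟪H ω, G l ω - g ω⟫_ℝ ∂μ = 0 := by
  have hle := samplesBefore_le hp hGm l
  have hgi : Integrable g μ := integrable_condExp.congr hg
  have h1 : μ[G l | p] =ᵐ[μ] μ[G l | samplesBefore p G l] := by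
    refine ae_eq_condExp_of_forall_setIntegral_eq hle hGi
      (fun t _ _ => integrable_condExp.integrableOn) (fun t ht _ => ?_)
      (stronglyMeasurable_condExp.mono
        (le_sup_left : p ≤ samplesBefore p G l)).aestronglyMeasurable
    exact (setIntegral_condExp_of_indicator hp hle (hGm l) hGi
      (fun A hA t ht => hG.setIntegral_indicator hp hGm l hA ht) ht).symm
  have h2 : μ[g | samplesBefore p G l] =ᵐ[μ] g :=
    condExp_of_aestronglyMeasurable' hle
      ⟨μ[G l | p], stronglyMeasurable_condExp.mono le_sup_left, hg.symm⟩ hgi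
  have h3 : μ[fun ω => G l ω - g ω | samplesBefore p G l] =ᵐ[μ] 0 := by
    filter_upwards [condExp_sub hGi hgi (samplesBefore p G l), h1, h2, hg] with ω e1 e2 e3 e4
    change (μ[G l - g | samplesBefore p G l]) ω = 0
    rw [e1, Pi.sub_apply, ← e2, e3, e4, sub_self]
  have h4 := condExp_bilin_of_aestronglyMeasurable_left (innerSL ℝ)
    (hH.stronglyMeasurable).aestronglyMeasurable hHi (hGi.sub hgi)
  rw [← integral_condExp hle]
  refine integral_eq_zero_of_ae ?_
  filter_upwards [h4, h3] with ω e1 e2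
  refine Eq.trans e1 ?_
  rw [e2]; simp

end Samples

/-! ### A von Bahr–Esseen type bound for the weighted noise -/

section Moment

variable {m n : ℕ} {Ω : Type*} {p : MeasurableSpace Ω} [mΩ : MeasurableSpace Ω] {μ : Measure Ω}

theorem integrable_norm_rpow_iff_memLp {α : ℝ} (hα : 1 < α) {Y : Ω → Mat m n}
    (hY : AEStronglyMeasurable Y μ) :
    Integrable (fun ω => ‖Y ω‖ ^ α) μ ↔ MemLp Y (ENNReal.ofReal α) μ := by
  have h := integrable_norm_rpow_iff (p := ENNReal.ofReal α) hY (by simp; linarith) (by simp)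
  rwa [ENNReal.toReal_ofReal (by linarith)] at h

theorem norm_rpow_smul_self {α : ℝ} (hα : 1 < α) (y : Mat m n) :
    ‖‖y‖ ^ (α - 2) • y‖ = ‖y‖ ^ (α - 1) := by
  rw [norm_smul, Real.norm_of_nonneg (by positivity)]
  rcases (norm_nonneg y).eq_or_lt with h | h
  · rw [← h, Real.zero_rpow (by linarith : α - 1 ≠ 0), mul_zero]
  · rw [← Real.rpow_add_one h.ne']; congr 1; ring

theorem rpow_sub_one_mul_le {α a b : ℝ} (hα : 1 < α) (ha : 0 ≤ a) (hb : 0 ≤ b) :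
    a ^ (α - 1) * b ≤ a ^ α + b ^ α := by
  have e : ∀ c : ℝ, 0 ≤ c → c ^ (α - 1) * c = c ^ α := fun c hc => by
    rcases hc.eq_or_lt with h | h
    · rw [← h, mul_zero, Real.zero_rpow (by linarith)]
    · rw [← Real.rpow_add_one h.ne']; congr 1; ring
  have ha' := Real.rpow_nonneg ha α
  have hb' := Real.rpow_nonneg hb α
  rcases le_total a b with h | h
  · have := mul_le_mul_of_nonneg_right (Real.rpow_le_rpow ha h (by linarith : 0 ≤ α - 1)) hb
    rw [e b hb] at this
    linarith
  · have := mul_le_mul_of_nonneg_left h (Real.rpow_nonneg ha (α - 1))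
    rw [e a ha] at this
    linarith

variable [IsProbabilityMeasure μ]

theorem Integrable.rpow_of_le_one {q : ℝ} (hq₀ : 0 ≤ q) (hq₁ : q ≤ 1) {h : Ω → ℝ}
    (hi : Integrable h μ) (h0 : 0 ≤ᵐ[μ] h) : Integrable (fun ω => h ω ^ q) μ := by
  refine ((integrable_const (1 : ℝ)).add hi).mono'
    (hi.aestronglyMeasurable.aemeasurable.pow_const q).aestronglyMeasurable ?_
  filter_upwards [h0] with ω hω
  have hω : 0 ≤ h ω := hω
  rw [Real.norm_of_nonneg (Real.rpow_nonneg hω q)]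
  have h1 := rpow_le_tangent hq₀ hq₁ hω one_pos
  simp only [Real.one_rpow, mul_one, Pi.add_apply] at h1 ⊢
  nlinarith

/-- Adding to `Y` one batch of conditionally independent centered samples, with conditional
`α`-moments at most `s ^ α + u ^ α`. The root `(‖·‖ ^ α + r) ^ (1 / α)` grows by the deterministic
`s ^ α` inside the root and by a multiple of `u` outside of it. The tangent of the root at the
conditional mean takes the place of Jensen's inequality. -/
theorem CondIndepFamily.integral_root_step {α : ℝ} (hα₁ : 1 < α) (hα₂ : α ≤ 2) (hp : p ≤ mΩ)
    {B : ℕ} {G : Fin B → Ω → Mat m n} (hGm : ∀ i, Measurable (G i)) (hG : CondIndepFamily μ p G)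
    (hGi : ∀ i, Integrable (G i) μ) {g : Ω → Mat m n} (hgm : Measurable[p] g)
    (hg : ∀ i, μ[G i | p] =ᵐ[μ] g) (hmom : ∀ i, Integrable (fun ω => ‖G i ω - g ω‖ ^ α) μ)
    {s : ℝ} {u : Ω → ℝ} (hs : 0 ≤ s) (hu : ∀ ω, 0 ≤ u ω) (hui : Integrable u μ)
    (hbound : ∀ i, ∀ᵐ ω ∂μ, (μ[fun ω' => ‖G i ω' - g ω'‖ ^ α | p]) ω ≤ s ^ α + u ω ^ α)
    {Y : Ω → Mat m n} (hYm : Measurable[p] Y) (hY : MemLp Y (ENNReal.ofReal α) μ)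
    (b : ℝ) {r : ℝ} (hr : 0 < r) :
    ∫ ω, (‖Y ω + b • ∑ i, (G i ω - g ω)‖ ^ α + r) ^ (1 / α) ∂μ
      ≤ ∫ ω, (‖Y ω‖ ^ α + (r + 2 * B * |b| ^ α * s ^ α)) ^ (1 / α) ∂μ
        + (2 * B * |b| ^ α) ^ (1 / α) * ∫ ω, u ω ∂μ := by
  have hα₀ : 0 < α := by linarith
  have hq₀ : (0 : ℝ) ≤ 1 / α := by positivity
  have hq₁ : 1 / α ≤ 1 := by rw [div_le_one hα₀]; linarith
  have hgm' : Measurable g := hgm.mono hp le_rfl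
  set x : ℕ → Ω → Mat m n := fun i ω => if h : i < B then b • (G ⟨i, h⟩ ω - g ω) else 0 with hx
  have hxF : ∀ (i : Fin B) ω, x i ω = b • (G i ω - g ω) := fun i ω => by simp [hx]
  have hxmem : ∀ i, MemLp (x i) (ENNReal.ofReal α) μ := by
    intro i
    by_cases hi : i < B
    · have : x i = fun ω => b • (G ⟨i, hi⟩ ω - g ω) := funext fun ω => by simp [hx, hi]
      rw [this]
      exact ((integrable_norm_rpow_iff_memLp hα₁
        ((hGm _).sub hgm').aestronglyMeasurable).1 (hmom ⟨i, hi⟩)).const_smul b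
    · have : x i = fun _ => 0 := funext fun ω => by simp [hx, hi]
      rw [this]
      exact MemLp.zero
  set P : ℕ → Ω → Mat m n := fun l ω => Y ω + ∑ i ∈ Finset.range l, x i ω with hP
  have hPmem : ∀ l, MemLp (P l) (ENNReal.ofReal α) μ := fun l =>
    hY.add (memLp_finsetSum _ fun i _ => hxmem i)
  have hnorm : ∀ {Q : Ω → Mat m n}, MemLp Q (ENNReal.ofReal α) μ →
      Integrable (fun ω => ‖Q ω‖ ^ α) μ := fun hQ =>
    (integrable_norm_rpow_iff_memLp hα₁ hQ.aestronglyMeasurable).2 hQ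
  have hPB : ∀ ω, P B ω = Y ω + b • ∑ i, (G i ω - g ω) := fun ω => by
    simp only [hP]
    rw [Finset.smul_sum, Finset.sum_range]
    simp only [hxF]
  have hPm : ∀ l ≤ B, Measurable[samplesBefore p G l] (P l) := fun l hl => by
    refine (hYm.mono le_sup_left le_rfl).add (Finset.measurable_fun_sum _ fun i hi => ?_)
    have hi := Finset.mem_range.1 hi
    have hiB : i < B := hi.trans_le hl
    have : x i = fun ω => b • (G ⟨i, hiB⟩ ω - g ω) := funext fun ω => by simp [hx, hiB]
    rw [this]
    exact ((measurable_samplesBefore p G (i := ⟨i, hiB⟩) hi).sub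
      (hgm.mono le_sup_left le_rfl)).const_smul b
  -- `W` is the conditional mean, up to the constants of `norm_add_sum_rpow_le`
  set e : Fin B → Ω → ℝ := fun i => μ[fun ω' => ‖G i ω' - g ω'‖ ^ α | p] with he
  have he0 : ∀ i, 0 ≤ᵐ[μ] e i := fun i =>
    condExp_nonneg (ae_of_all _ fun ω => Real.rpow_nonneg (norm_nonneg _) _)
  have hei : ∀ i, Integrable (e i) μ := fun i => integrable_condExp
  have hem : ∀ i, Measurable[p] (e i) := fun i => stronglyMeasurable_condExp.measurable
  set W : Ω → ℝ := fun ω => ‖Y ω‖ ^ α + r + 2 * |b| ^ α * ∑ i, e i ω with hW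
  have hWm : Measurable[p] W := (((measurable_norm.comp hYm).pow_const α).add_const r).add
    ((Finset.measurable_fun_sum _ fun i _ => hem i).const_mul _)
  have hWr : ∀ᵐ ω ∂μ, r ≤ W ω := by
    filter_upwards [ae_all_iff.2 he0] with ω hω
    have : 0 ≤ ∑ i, e i ω := Finset.sum_nonneg fun i _ => hω i
    simp only [hW]
    have := Real.rpow_nonneg (norm_nonneg (Y ω)) α
    have : 0 ≤ 2 * |b| ^ α * ∑ i, e i ω := by positivity
    linarith
  set w : Ω → ℝ := fun ω => 1 / α * W ω ^ (1 / α - 1) with hw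
  have hwm : Measurable[p] w := (hWm.pow_const _).const_mul _
  have hwm' : AEStronglyMeasurable w μ := (hwm.mono hp le_rfl).aestronglyMeasurable
  have hwb : ∀ᵐ ω ∂μ, ‖w ω‖ ≤ 1 / α * r ^ (1 / α - 1) := by
    filter_upwards [hWr] with ω hω
    have hWpos : 0 < W ω := hr.trans_le hω
    rw [Real.norm_of_nonneg (by positivity)]
    exact mul_le_mul_of_nonneg_left (Real.rpow_le_rpow_of_nonpos hr hω (by linarith)) hq₀
  set H : Fin B → Ω → Mat m n := fun l ω => w ω • (‖P l ω‖ ^ (α - 2) • P l ω) with hH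
  have hHi : ∀ l : Fin B, Integrable (fun ω => ⟪H l ω, G l ω - g ω⟫_ℝ) μ := by
    intro l
    have hbase : Integrable (fun ω => ⟪‖P l ω‖ ^ (α - 2) • P l ω, G l ω - g ω⟫_ℝ) μ := by
      refine ((hnorm (hPmem l)).add (hmom l)).mono' ?_ (ae_of_all _ fun ω => ?_)
      · have hPl : Measurable (P l) :=
          (hPm l l.2.le).mono (samplesBefore_le hp hGm l) le_rfl
        exact (((hPl.norm.pow_const _).smul hPl).inner
          ((hGm l).sub hgm')).aestronglyMeasurable
      · refine (norm_inner_le_norm _ _).trans ?_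
        rw [norm_rpow_smul_self hα₁]
        exact rpow_sub_one_mul_le hα₁ (norm_nonneg _) (norm_nonneg _)
    have := hbase.bdd_mul hwm' hwb
    refine this.congr (ae_of_all _ fun ω => ?_)
    simp only [hH]
    rw [real_inner_smul_left _ _ (w ω)]
  have horth : ∀ l : Fin B, ∫ ω, ⟪H l ω, G l ω - g ω⟫_ℝ ∂μ = 0 := by
    intro l
    refine hG.integral_inner_eq_zero hp hGm l (hGi l) (hg l) ?_ (hHi l)
    have hPl := hPm l l.2.le
    exact (hwm.mono le_sup_left le_rfl).smul
      (((measurable_norm.comp hPl).pow_const _).smul hPl)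
  have hwe : ∀ l : Fin B, Integrable (fun ω => w ω * (‖G l ω - g ω‖ ^ α - e l ω)) μ := fun l =>
    ((hmom l).sub (hei l)).bdd_mul hwm' hwb
  have hwe0 : ∀ l : Fin B, ∫ ω, w ω * (‖G l ω - g ω‖ ^ α - e l ω) ∂μ = 0 := by
    intro l
    have h1 := (hmom l).bdd_mul hwm' hwb
    have h2 := (hei l).bdd_mul hwm' hwb
    have h3 := condExp_mul_of_aestronglyMeasurable_left (μ := μ)
      hwm.stronglyMeasurable.aestronglyMeasurable h1 (hmom l)
    have h4 := integral_condExp (μ := μ) hp (f := w * fun ω => ‖G l ω - g ω‖ ^ α)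
    rw [integral_congr_ae h3] at h4
    simp only [mul_sub]
    rw [integral_sub h1 h2, sub_eq_zero]
    exact h4.symm
  -- the pointwise inequality, to be integrated
  have hpt : ∀ᵐ ω ∂μ, (‖Y ω + b • ∑ i, (G i ω - g ω)‖ ^ α + r) ^ (1 / α) ≤
      ((‖Y ω‖ ^ α + (r + 2 * B * |b| ^ α * s ^ α)) ^ (1 / α) + (2 * B * |b| ^ α) ^ (1 / α) * u ω)
      + (α * ∑ l, b * ⟪H l ω, G l ω - g ω⟫_ℝ
        + 2 * |b| ^ α * ∑ l, w ω * (‖G l ω - g ω‖ ^ α - e l ω)) := by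
    filter_upwards [hWr, ae_all_iff.2 hbound] with ω h1 h2
    have hWpos : 0 < W ω := hr.trans_le h1
    have hw0 : 0 ≤ w ω := by simp only [hw]; positivity
    have hA := rpow_le_tangent hq₀ hq₁ (z := ‖P B ω‖ ^ α + r)
      (add_nonneg (Real.rpow_nonneg (norm_nonneg _) _) hr.le) hWpos
    have hB := norm_add_sum_rpow_le hα₁ hα₂ (Y ω) (fun i => x i ω) B
    have hC : W ω ^ (1 / α) ≤ (‖Y ω‖ ^ α + (r + 2 * B * |b| ^ α * s ^ α)) ^ (1 / α)
        + (2 * B * |b| ^ α) ^ (1 / α) * u ω := by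
      refine le_trans (Real.rpow_le_rpow hWpos.le ?_ hq₀)
        (rpow_add_rpow_root_le hα₁ (by positivity) (by positivity) (hu ω))
      have hsum : ∑ i, e i ω ≤ B * (s ^ α + u ω ^ α) := by
        calc ∑ i, e i ω ≤ ∑ _i : Fin B, (s ^ α + u ω ^ α) := Finset.sum_le_sum fun i _ => h2 i
          _ = _ := by simp [mul_add]
      have := mul_le_mul_of_nonneg_left hsum (by positivity : 0 ≤ 2 * |b| ^ α)
      simp only [hW]
      linarith
    have hD : ∑ l ∈ Finset.range B, ⟪‖Y ω + ∑ i ∈ Finset.range l, x i ω‖ ^ (α - 2) •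
        (Y ω + ∑ i ∈ Finset.range l, x i ω), x l ω⟫_ℝ
        = ∑ l : Fin B, b * ⟪‖P l ω‖ ^ (α - 2) • P l ω, G l ω - g ω⟫_ℝ := by
      rw [Finset.sum_range]
      refine Finset.sum_congr rfl fun l _ => ?_
      rw [hxF, inner_smul_right]
    have hE : ∑ l ∈ Finset.range B, ‖x l ω‖ ^ α = |b| ^ α * ∑ l : Fin B, ‖G l ω - g ω‖ ^ α := by
      rw [Finset.sum_range, Finset.mul_sum]
      refine Finset.sum_congr rfl fun l _ => ?_
      rw [hxF, norm_smul, Real.norm_eq_abs, Real.mul_rpow (abs_nonneg _) (norm_nonneg _)]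
    rw [hD, hE] at hB
    have hF := mul_le_mul_of_nonneg_left hB hw0
    have hwH : ∑ l : Fin B, b * ⟪H l ω, G l ω - g ω⟫_ℝ
        = w ω * ∑ l : Fin B, b * ⟪‖P l ω‖ ^ (α - 2) • P l ω, G l ω - g ω⟫_ℝ := by
      rw [Finset.mul_sum]
      refine Finset.sum_congr rfl fun l _ => ?_
      simp only [hH]
      rw [real_inner_smul_left _ _ (w ω)]
      ring
    have hwE : ∑ l, w ω * (‖G l ω - g ω‖ ^ α - e l ω)
        = w ω * (∑ l, ‖G l ω - g ω‖ ^ α - ∑ l, e l ω) := by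
      rw [← Finset.mul_sum, Finset.sum_sub_distrib]
    rw [← hPB, hwH, hwE]
    have hA' : (‖P B ω‖ ^ α + r) ^ (1 / α) ≤ W ω ^ (1 / α) + w ω * (‖P B ω‖ ^ α + r - W ω) := hA
    have hF' : w ω * ‖P B ω‖ ^ α ≤ _ := hF
    have hWe : w ω * W ω = w ω * (‖Y ω‖ ^ α + r + 2 * |b| ^ α * ∑ i, e i ω) := rfl
    linear_combination hA' + hC + hF' - hWe
  have i1 : Integrable (fun ω => (‖Y ω + b • ∑ i, (G i ω - g ω)‖ ^ α + r) ^ (1 / α)) μ := by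
    have h := Integrable.rpow_of_le_one hq₀ hq₁ ((hnorm (hPmem B)).add (integrable_const r))
      (ae_of_all _ fun ω => add_nonneg (Real.rpow_nonneg (norm_nonneg _) _) hr.le)
    refine h.congr (ae_of_all _ fun ω => ?_)
    simp only [Pi.add_apply, hPB]
  have i2 : Integrable (fun ω => (‖Y ω‖ ^ α + (r + 2 * B * |b| ^ α * s ^ α)) ^ (1 / α)) μ :=
    Integrable.rpow_of_le_one hq₀ hq₁ ((hnorm hY).add (integrable_const _))
      (ae_of_all _ fun ω => add_nonneg (Real.rpow_nonneg (norm_nonneg _) _) (by positivity))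
  have i3 := hui.const_mul ((2 * B * |b| ^ α) ^ (1 / α))
  have i4 : Integrable (fun ω => α * ∑ l, b * ⟪H l ω, G l ω - g ω⟫_ℝ) μ :=
    (integrable_finsetSum _ fun l _ => (hHi l).const_mul b).const_mul α
  have i5 : Integrable (fun ω => 2 * |b| ^ α * ∑ l, w ω * (‖G l ω - g ω‖ ^ α - e l ω)) μ :=
    (integrable_finsetSum _ fun l _ => hwe l).const_mul _
  have hint := integral_mono_ae i1 ((i2.add i3).add (i4.add i5)) hpt
  refine hint.trans (le_of_eq ?_)
  have z4 : ∫ ω, α * ∑ l, b * ⟪H l ω, G l ω - g ω⟫_ℝ ∂μ = 0 := by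
    rw [integral_const_mul, integral_finsetSum _ fun l _ => (hHi l).const_mul b]
    simp only [integral_const_mul, horth, mul_zero, Finset.sum_const_zero]
  have z5 : ∫ ω, 2 * |b| ^ α * ∑ l, w ω * (‖G l ω - g ω‖ ^ α - e l ω) ∂μ = 0 := by
    rw [integral_const_mul, integral_finsetSum _ fun l _ => hwe l]
    simp only [hwe0, mul_zero, Finset.sum_const_zero]
  calc _ = (∫ ω, (‖Y ω‖ ^ α + (r + 2 * B * |b| ^ α * s ^ α)) ^ (1 / α) ∂μ
        + ∫ ω, (2 * B * |b| ^ α) ^ (1 / α) * u ω ∂μ)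
        + (∫ ω, α * ∑ l, b * ⟪H l ω, G l ω - g ω⟫_ℝ ∂μ
        + ∫ ω, 2 * |b| ^ α * ∑ l, w ω * (‖G l ω - g ω‖ ^ α - e l ω) ∂μ) := by
        rw [integral_add' (i2.add i3) (i4.add i5), integral_add' i2 i3, integral_add' i4 i5]
    _ = _ := by rw [z4, z5, integral_const_mul]; ring

end Moment

/-- The gradient noise `G_k - ∇f(X_k)` of a mini-batch. -/
noncomputable def batchNoise {m n B : ℕ} {Ω : Type*} (f : Mat m n → ℝ) (X : ℕ → Ω → Mat m n)
    (G : ℕ → Fin B → Ω → Mat m n) (k : ℕ) (ω : Ω) : Mat m n :=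
  batchGrad G k ω - ∇ f (X k ω)

theorem batchNoise_eq {m n B : ℕ} {Ω : Type*} (hB : 0 < B) (f : Mat m n → ℝ) (X : ℕ → Ω → Mat m n)
    (G : ℕ → Fin B → Ω → Mat m n) (k : ℕ) (ω : Ω) :
    batchNoise f X G k ω = (1 / (B : ℝ)) • ∑ i, (G k i ω - ∇ f (X k ω)) := by
  have : (B : ℝ) ≠ 0 := by positivity
  rw [batchNoise, batchGrad, Finset.sum_sub_distrib, smul_sub]
  simp [← Nat.cast_smul_eq_nsmul ℝ, smul_smul, this]

/-- The factor `2 ^ (1 / α) / B ^ ((α - 1) / α)` by which averaging `B` samples scales the size of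
the noise. -/
noncomputable def noiseScale (α : ℝ) (B : ℕ) : ℝ := (2 * (B : ℝ) ^ (1 - α)) ^ (1 / α)

theorem noiseScale_nonneg (α : ℝ) (B : ℕ) : 0 ≤ noiseScale α B := by
  unfold noiseScale; positivity

section Noise

variable {m n B : ℕ} {Ω : Type*} [mΩ : MeasurableSpace Ω] {μ : Measure Ω}
  {ℱ : Filtration ℕ mΩ} {K : ℕ} {f : Mat m n → ℝ} {X : ℕ → Ω → Mat m n}
  {G : ℕ → Fin B → Ω → Mat m n} {α σ₀ σ₁ : ℝ}

theorem HeavyTailedNoise.integrable_gradient (h : HeavyTailedNoise μ ℱ K f X G α σ₀ σ₁)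
    (hB : 0 < B) {k : ℕ} (hk : k < K) : Integrable (fun ω => ∇ f (X k ω)) μ :=
  integrable_condExp.congr (h.unbiased k hk ⟨0, hB⟩)

theorem HeavyTailedNoise.memLp_batchNoise (h : HeavyTailedNoise μ ℱ K f X G α σ₀ σ₁)
    (hα : 1 < α) (hB : 0 < B) {k : ℕ} (hk : k < K) :
    MemLp (batchNoise f X G k) (ENNReal.ofReal α) μ := by
  have e : batchNoise f X G k = fun ω => (1 / (B : ℝ)) • ∑ i, (G k i ω - ∇ f (X k ω)) :=
    funext fun ω => batchNoise_eq hB f X G k ω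
  rw [e]
  refine MemLp.const_smul (f := fun ω => ∑ i, (G k i ω - ∇ f (X k ω)))
    (memLp_finsetSum _ fun i _ => ?_) (1 / (B : ℝ))
  exact (integrable_norm_rpow_iff_memLp hα ((h.integrable k hk i).sub
    (h.integrable_gradient hB hk)).aestronglyMeasurable).1 (h.integrable_moment k hk i)

variable [IsProbabilityMeasure μ]

theorem HeavyTailedNoise.integrable_batchNoise (h : HeavyTailedNoise μ ℱ K f X G α σ₀ σ₁)
    (hα : 1 < α) (hB : 0 < B) {k : ℕ} (hk : k < K) : Integrable (batchNoise f X G k) μ :=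
  (h.memLp_batchNoise hα hB hk).integrable (by simpa using hα.le)

/-- Peeling off the batches from the last to the first with `CondIndepFamily.integral_root_step`;
the regularization `r` absorbs the deterministic part of the batches already removed. -/
theorem HeavyTailedNoise.integral_root_sum_le (h : HeavyTailedNoise μ ℱ K f X G α σ₀ σ₁)
    (hα₁ : 1 < α) (hα₂ : α ≤ 2) (hB : 0 < B) (hσ₀ : 0 ≤ σ₀) (hσ₁ : 0 ≤ σ₁)
    (hf : Measurable (∇ f)) (hX : ∀ k < K, Measurable[ℱ k] (X k))
    (hG : ∀ k < K, ∀ i, Measurable[ℱ (k + 1)] (G k i)) (a : ℕ → ℝ) {N : ℕ} (hN : N ≤ K) :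
    ∀ r : ℝ, 0 < r →
    ∫ ω, (‖∑ j ∈ Finset.range N, a j • batchNoise f X G j ω‖ ^ α + r) ^ (1 / α) ∂μ
      ≤ (r + 2 * (B : ℝ) ^ (1 - α) * (σ₀ ^ α * ∑ j ∈ Finset.range N, |a j| ^ α)) ^ (1 / α)
        + noiseScale α B * (σ₁ * ∑ j ∈ Finset.range N, |a j| * ∫ ω, ‖∇ f (X j ω)‖ ∂μ) := by
  have hα₀ : 0 < α := by linarith
  have hB' : (0 : ℝ) < B := by exact_mod_cast hB
  induction N with
  | zero => intro r hr; simp [Real.zero_rpow hα₀.ne']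
  | succ N ih =>
    intro r hr
    have hNK : N < K := hN
    have hgrad : Measurable[ℱ N] fun ω => ∇ f (X N ω) := hf.comp (hX N hNK)
    have hnoise : ∀ j < N, Measurable[ℱ N] (batchNoise f X G j) := fun j hj => by
      have hjK := hj.trans hNK
      refine Measurable.sub (Measurable.const_smul (g := fun ω => ∑ i, G j i ω)
        (Finset.measurable_fun_sum _ fun i _ => ?_) (1 / (B : ℝ))) ?_
      · exact (hG j hjK i).mono (ℱ.mono hj) le_rfl
      · exact (hf.comp (hX j hjK)).mono (ℱ.mono hj.le) le_rfl
    have hstep := (h.condIndep N hNK).integral_root_step hα₁ hα₂ (ℱ.le N)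
      (fun i => (hG N hNK i).mono (ℱ.le _) le_rfl) (h.integrable N hNK) hgrad (h.unbiased N hNK)
      (h.integrable_moment N hNK) (s := σ₀) (u := fun ω => σ₁ * ‖∇ f (X N ω)‖) hσ₀
      (fun ω => by positivity) ((h.integrable_gradient hB hNK).norm.const_mul σ₁)
      (fun i => by
        filter_upwards [h.moment N hNK i] with ω hω
        rwa [Real.mul_rpow hσ₁ (norm_nonneg _)])
      (Y := fun ω => ∑ j ∈ Finset.range N, a j • batchNoise f X G j ω)
      (Finset.measurable_fun_sum _ fun j hj => (hnoise j (Finset.mem_range.1 hj)).const_smul (a j))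
      (memLp_finsetSum _ fun j hj =>
        (h.memLp_batchNoise hα₁ hB ((Finset.mem_range.1 hj).trans hNK)).const_smul (a j))
      (a N * (1 / B)) hr
    -- averaging: `B * |a / B| ^ α = B ^ (1 - α) * |a| ^ α`
    have hτ : 2 * (B : ℝ) * |a N * (1 / B)| ^ α = 2 * (B : ℝ) ^ (1 - α) * |a N| ^ α := by
      rw [abs_mul, Real.mul_rpow (abs_nonneg _) (abs_nonneg _),
        abs_of_pos (one_div_pos.2 hB'),
        Real.div_rpow zero_le_one hB'.le, Real.one_rpow, Real.rpow_sub hB', Real.rpow_one]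
      field_simp
    have hτ' : (2 * (B : ℝ) ^ (1 - α) * |a N| ^ α) ^ (1 / α) = noiseScale α B * |a N| := by
      rw [Real.mul_rpow (by positivity) (by positivity), ← Real.rpow_mul (abs_nonneg _),
        mul_one_div_cancel hα₀.ne', Real.rpow_one, noiseScale]
    rw [hτ, hτ', integral_const_mul] at hstep
    have hih := ih hNK.le (r + 2 * (B : ℝ) ^ (1 - α) * |a N| ^ α * σ₀ ^ α) (by positivity)
    have e1 : ∀ ω, ∑ j ∈ Finset.range (N + 1), a j • batchNoise f X G j ω =
        ∑ j ∈ Finset.range N, a j • batchNoise f X G j ω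
          + (a N * (1 / (B : ℝ))) • ∑ i, (G N i ω - ∇ f (X N ω)) := fun ω => by
      rw [Finset.sum_range_succ, batchNoise_eq hB f X G N, smul_smul]
    simp only [e1]
    refine hstep.trans ((add_le_add_left hih _).trans (le_of_eq ?_))
    rw [Finset.sum_range_succ, Finset.sum_range_succ]
    have e2 : r + 2 * (B : ℝ) ^ (1 - α) * |a N| ^ α * σ₀ ^ α
        + 2 * (B : ℝ) ^ (1 - α) * (σ₀ ^ α * ∑ j ∈ Finset.range N, |a j| ^ α)
        = r + 2 * (B : ℝ) ^ (1 - α)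
          * (σ₀ ^ α * (∑ j ∈ Finset.range N, |a j| ^ α + |a N| ^ α)) := by ring
    rw [e2]
    ring

/-- Expected size of a weighted sum of noise terms. The multiplicative part `σ₁ ‖∇f(X_j)‖` enters
through first moments of the gradients, of which no higher moments are known. -/
theorem HeavyTailedNoise.integral_norm_sum_le (h : HeavyTailedNoise μ ℱ K f X G α σ₀ σ₁)
    (hα₁ : 1 < α) (hα₂ : α ≤ 2) (hB : 0 < B) (hσ₀ : 0 ≤ σ₀) (hσ₁ : 0 ≤ σ₁)
    (hf : Measurable (∇ f)) (hX : ∀ k < K, Measurable[ℱ k] (X k))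
    (hG : ∀ k < K, ∀ i, Measurable[ℱ (k + 1)] (G k i)) (a : ℕ → ℝ) {N : ℕ} (hN : N ≤ K) :
    ∫ ω, ‖∑ j ∈ Finset.range N, a j • batchNoise f X G j ω‖ ∂μ
      ≤ noiseScale α B * (σ₀ * (∑ j ∈ Finset.range N, |a j| ^ α) ^ (1 / α)
        + σ₁ * ∑ j ∈ Finset.range N, |a j| * ∫ ω, ‖∇ f (X j ω)‖ ∂μ) := by
  have hα₀ : 0 < α := by linarith
  have hq₀ : (0 : ℝ) ≤ 1 / α := by positivity
  have hmem : MemLp (fun ω => ∑ j ∈ Finset.range N, a j • batchNoise f X G j ω)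
      (ENNReal.ofReal α) μ := memLp_finsetSum _ fun j hj =>
    (h.memLp_batchNoise hα₁ hB ((Finset.mem_range.1 hj).trans_le hN)).const_smul (a j)
  refine le_of_forall_pos_le_add fun ε hε => ?_
  have hr : 0 < ε ^ α := Real.rpow_pos_of_pos hε α
  have hroot : ∀ c : ℝ, 0 ≤ c → (c ^ α) ^ (1 / α) = c := fun c hc => by
    rw [← Real.rpow_mul hc, mul_one_div_cancel hα₀.ne', Real.rpow_one]
  have h1 := h.integral_root_sum_le hα₁ hα₂ hB hσ₀ hσ₁ hf hX hG a hN _ hr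
  have hsum : 0 ≤ ∑ j ∈ Finset.range N, |a j| ^ α :=
    Finset.sum_nonneg fun j _ => Real.rpow_nonneg (abs_nonneg _) _
  have h2 : (ε ^ α + 2 * (B : ℝ) ^ (1 - α)
      * (σ₀ ^ α * ∑ j ∈ Finset.range N, |a j| ^ α)) ^ (1 / α)
      ≤ ε + noiseScale α B * (σ₀ * (∑ j ∈ Finset.range N, |a j| ^ α) ^ (1 / α)) := by
    refine (Real.rpow_add_le_add_rpow hr.le (by positivity) hq₀
      (by rw [div_le_one hα₀]; linarith)).trans (le_of_eq ?_)
    rw [hroot ε hε.le, Real.mul_rpow (by positivity) (by positivity),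
      Real.mul_rpow (by positivity) hsum, hroot σ₀ hσ₀, noiseScale]
  have h3 : ∫ ω, ‖∑ j ∈ Finset.range N, a j • batchNoise f X G j ω‖ ∂μ ≤
      ∫ ω, (‖∑ j ∈ Finset.range N, a j • batchNoise f X G j ω‖ ^ α + ε ^ α) ^ (1 / α) ∂μ := by
    refine integral_mono (hmem.integrable (by simpa using hα₁.le)).norm ?_ fun ω => ?_
    · exact Integrable.rpow_of_le_one hq₀ (by rw [div_le_one hα₀]; linarith)
        (((integrable_norm_rpow_iff_memLp hα₁ hmem.aestronglyMeasurable).2 hmem).add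
          (integrable_const _))
        (ae_of_all _ fun ω => add_nonneg (Real.rpow_nonneg (norm_nonneg _) _) hr.le)
    · dsimp only
      conv_lhs => rw [← hroot _ (norm_nonneg (∑ j ∈ Finset.range N, a j • batchNoise f X G j ω))]
      exact Real.rpow_le_rpow (by positivity) (by linarith) hq₀
  linarith

end Noise

/-! ### Directions computed with fresh randomness -/

section Fresh

variable {Ω Z E : Type*} {H : MeasurableSpace Ω} [mΩ : MeasurableSpace Ω] [MeasurableSpace Z]
  [MeasurableSpace E] {μ : Measure Ω} [IsProbabilityMeasure μ] {M : Ω → E} {ζ : Ω → Z}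

/-- A seed independent of the past can be integrated out first. -/
theorem lintegral_mul_fresh (hH : H ≤ mΩ) (hM : Measurable[H] M) (hζ : Measurable ζ)
    (hind : Indep (MeasurableSpace.comap ζ inferInstance) H μ) {q : E → Z → ENNReal}
    (hq : Measurable (Function.uncurry q)) {s : Ω → ENNReal} (hs : Measurable[H] s) :
    ∫⁻ ω, s ω * q (M ω) (ζ ω) ∂μ = ∫⁻ ω, s ω * ∫⁻ z, q (M ω) z ∂(μ.map ζ) ∂μ := by
  have hV : Measurable[H] fun ω => (s ω, M ω) := hs.prodMk hM
  have hV' : Measurable fun ω => (s ω, M ω) := hV.mono hH le_rfl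
  have hindep : IndepFun (fun ω => (s ω, M ω)) ζ μ := by
    rw [IndepFun_iff_Indep]
    exact (indep_of_indep_of_le_right hind hV.comap_le).symm
  have hlaw := (indepFun_iff_map_prod_eq_prod_map_map hV'.aemeasurable hζ.aemeasurable).1 hindep
  have hF : Measurable fun y : (ENNReal × E) × Z => y.1.1 * q y.1.2 y.2 :=
    (measurable_fst.fst).mul (hq.comp ((measurable_fst.snd).prodMk measurable_snd))
  have : IsProbabilityMeasure (μ.map ζ) := Measure.isProbabilityMeasure_map hζ.aemeasurable
  have : IsProbabilityMeasure (μ.map fun ω => (s ω, M ω)) :=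
    Measure.isProbabilityMeasure_map hV'.aemeasurable
  calc ∫⁻ ω, s ω * q (M ω) (ζ ω) ∂μ
      = ∫⁻ y, y.1.1 * q y.1.2 y.2 ∂(μ.map fun ω => ((s ω, M ω), ζ ω)) :=
        (lintegral_map hF (hV'.prodMk hζ)).symm
    _ = ∫⁻ v, ∫⁻ z, v.1 * q v.2 z ∂(μ.map ζ) ∂(μ.map fun ω => (s ω, M ω)) := by
        rw [hlaw, lintegral_prod _ hF.aemeasurable]
    _ = ∫⁻ ω, ∫⁻ z, s ω * q (M ω) z ∂(μ.map ζ) ∂μ :=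
        lintegral_map hF.lintegral_prod_right' hV'
    _ = _ := by
        refine lintegral_congr fun ω => lintegral_const_mul _ ?_
        exact hq.comp (measurable_const.prodMk measurable_id)

/-- A bound on `q (M, ζ)` that holds on average given `M` alone also holds on average given the
whole past, since the seed `ζ` is fresh. -/
theorem lintegral_mul_fresh_le (hH : H ≤ mΩ) (hM : Measurable[H] M) (hζ : Measurable ζ)
    (hind : Indep (MeasurableSpace.comap ζ inferInstance) H μ) {q : E → Z → ENNReal}
    (hq : Measurable (Function.uncurry q)) {c : ENNReal}
    (hc : ∀ A, MeasurableSet A → ∫⁻ ω in M ⁻¹' A, q (M ω) (ζ ω) ∂μ ≤ c * μ (M ⁻¹' A))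
    {s : Ω → ENNReal} (hs : Measurable[H] s) :
    ∫⁻ ω, s ω * q (M ω) (ζ ω) ∂μ ≤ c * ∫⁻ ω, s ω ∂μ := by
  have hM' : Measurable M := hM.mono hH le_rfl
  have : IsProbabilityMeasure (μ.map ζ) := Measure.isProbabilityMeasure_map hζ.aemeasurable
  have : IsProbabilityMeasure (μ.map M) := Measure.isProbabilityMeasure_map hM'.aemeasurable
  set φ : E → ENNReal := fun x => ∫⁻ z, q x z ∂(μ.map ζ) with hφ
  have hφm : Measurable φ := hq.lintegral_prod_right'
  have hle : ∀ᵐ ω ∂μ, φ (M ω) ≤ c := by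
    refine ae_of_ae_map hM'.aemeasurable (p := fun x => φ x ≤ c)
      (ae_le_of_forall_setLIntegral_le_of_sigmaFinite hφm fun A hA _ => ?_)
    rw [setLIntegral_const, setLIntegral_map hA hφm hM', Measure.map_apply hM' hA]
    refine le_trans (le_of_eq ?_) (hc A hA)
    have hind1 : Measurable[H] ((M ⁻¹' A).indicator fun _ => (1 : ENNReal)) :=
      measurable_const.indicator (hM hA)
    have h := lintegral_mul_fresh hH hM hζ hind hq hind1
    have e : ∀ g : Ω → ENNReal, ∫⁻ ω, (M ⁻¹' A).indicator (fun _ => (1 : ENNReal)) ω * g ω ∂μ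
        = ∫⁻ ω in M ⁻¹' A, g ω ∂μ := fun g => by
      rw [← lintegral_indicator (hM' hA)]
      refine lintegral_congr fun ω => ?_
      by_cases hω : ω ∈ M ⁻¹' A
      · simp [Set.indicator_of_mem hω]
      · simp [Set.indicator_of_notMem hω]
    rw [e, e] at h
    exact h.symm
  rw [lintegral_mul_fresh hH hM hζ hind hq hs]
  calc ∫⁻ ω, s ω * φ (M ω) ∂μ ≤ ∫⁻ ω, c * s ω ∂μ := by
        refine lintegral_mono_ae ?_
        filter_upwards [hle] with ω hω
        rw [mul_comm]
        exact mul_le_mul_left hω _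
    _ = _ := lintegral_const_mul _ (hs.mono hH le_rfl)

end Fresh

section Polar

variable {m n : ℕ} {Ω Z : Type*} {H : MeasurableSpace Ω} [mΩ : MeasurableSpace Ω]
  [MeasurableSpace Z] {μ : Measure Ω} [IsProbabilityMeasure μ] {M : Ω → Mat m n} {ζ : Ω → Z}
  {T : Mat m n → Z → Mat m n} {c : ℝ} {s : Ω → ℝ}

/-- A second moment bound on the direction given `M` extends to weights `s` from the past. -/
theorem integral_mul_opNorm_sq_le (hH : H ≤ mΩ) (hM : Measurable[H] M) (hζ : Measurable ζ)
    (hind : Indep (MeasurableSpace.comap ζ inferInstance) H μ)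
    (hT : Measurable (Function.uncurry T))
    (hint : Integrable (fun ω => opNorm (T (M ω) (ζ ω)) ^ 2) μ) (hc : 0 ≤ c)
    (hbound : ∀ᵐ ω ∂μ, (μ[fun ω' => opNorm (T (M ω') (ζ ω')) ^ 2 |
      MeasurableSpace.comap M inferInstance]) ω ≤ c)
    (hs : Measurable[H] s) (hs0 : ∀ ω, 0 ≤ s ω) (hsi : Integrable s μ) :
    Integrable (fun ω => s ω * opNorm (T (M ω) (ζ ω)) ^ 2) μ ∧
      ∫ ω, s ω * opNorm (T (M ω) (ζ ω)) ^ 2 ∂μ ≤ c * ∫ ω, s ω ∂μ := by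
  have hM' : Measurable M := hM.mono hH le_rfl
  have hq : Measurable (Function.uncurry fun x z => ENNReal.ofReal (opNorm (T x z) ^ 2)) :=
    ((continuous_opNorm.measurable.comp hT).pow_const 2).ennreal_ofReal
  have hA : ∀ A, MeasurableSet A → ∫⁻ ω in M ⁻¹' A, ENNReal.ofReal (opNorm (T (M ω) (ζ ω)) ^ 2) ∂μ
      ≤ ENNReal.ofReal c * μ (M ⁻¹' A) := by
    intro A hA
    rw [← ofReal_integral_eq_lintegral_ofReal hint.integrableOn
      (ae_of_all _ fun ω => by positivity), ← setIntegral_condExp hM'.comap_le hint ⟨A, hA, rfl⟩,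
      ← ENNReal.ofReal_toReal (measure_ne_top μ (M ⁻¹' A)), ← ENNReal.ofReal_mul hc]
    refine ENNReal.ofReal_le_ofReal ?_
    calc _ ≤ ∫ _ω in M ⁻¹' A, c ∂μ :=
          integral_mono_ae integrable_condExp.integrableOn (integrable_const _)
            (ae_restrict_of_ae hbound)
      _ = _ := by simp [Measure.real, mul_comm]
  have hmain := lintegral_mul_fresh_le hH hM hζ hind hq hA hs.ennreal_ofReal
  simp only [← ENNReal.ofReal_mul (hs0 _)] at hmain
  rw [← ofReal_integral_eq_lintegral_ofReal hsi (ae_of_all _ hs0)] at hmain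
  have hnn : 0 ≤ᵐ[μ] fun ω => s ω * opNorm (T (M ω) (ζ ω)) ^ 2 :=
    ae_of_all _ fun ω => mul_nonneg (hs0 ω) (sq_nonneg _)
  have hI : Integrable (fun ω => s ω * opNorm (T (M ω) (ζ ω)) ^ 2) μ := by
    refine ⟨hsi.aestronglyMeasurable.mul hint.aestronglyMeasurable, ?_⟩
    rw [hasFiniteIntegral_iff_ofReal hnn]
    exact hmain.trans_lt (ENNReal.mul_lt_top ENNReal.ofReal_lt_top ENNReal.ofReal_lt_top)
  refine ⟨hI, ?_⟩
  rw [← ofReal_integral_eq_lintegral_ofReal hI hnn, ← ENNReal.ofReal_mul hc] at hmain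
  exact (ENNReal.ofReal_le_ofReal_iff (mul_nonneg hc (integral_nonneg hs0))).1 hmain

/-- The Frobenius norm of the direction against a weight from the past. The first moment comes from
the second one by `2 a x ≤ x ^ 2 + a ^ 2`, with `a = 1 + ν`. -/
theorem integral_mul_norm_le {ν : ℝ} (hH : H ≤ mΩ) (hM : Measurable[H] M) (hζ : Measurable ζ)
    (hind : Indep (MeasurableSpace.comap ζ inferInstance) H μ)
    (hT : Measurable (Function.uncurry T))
    (hint : Integrable (fun ω => opNorm (T (M ω) (ζ ω)) ^ 2) μ) (hν : 0 ≤ ν)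
    (hbound : ∀ᵐ ω ∂μ, (μ[fun ω' => opNorm (T (M ω') (ζ ω')) ^ 2 |
      MeasurableSpace.comap M inferInstance]) ω ≤ (1 + ν) ^ 2)
    (hs : Measurable[H] s) (hs0 : ∀ ω, 0 ≤ s ω) (hsi : Integrable s μ) :
    Integrable (fun ω => s ω * ‖T (M ω) (ζ ω)‖) μ ∧
      ∫ ω, s ω * ‖T (M ω) (ζ ω)‖ ∂μ ≤ √((min m n : ℕ) : ℝ) * (1 + ν) * ∫ ω, s ω ∂μ := by
  obtain ⟨h1, h2⟩ := integral_mul_opNorm_sq_le hH hM hζ hind hT hint (by positivity) hbound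
    hs hs0 hsi
  have hM' : Measurable M := hM.mono hH le_rfl
  have hD : Measurable fun ω => T (M ω) (ζ ω) := hT.comp (hM'.prodMk hζ)
  set a := √((min m n : ℕ) : ℝ) / (2 * (1 + ν)) with ha
  have ha0 : 0 ≤ a := by positivity
  have hpt : ∀ ω, s ω * ‖T (M ω) (ζ ω)‖ ≤
      a * (s ω * opNorm (T (M ω) (ζ ω)) ^ 2 + (1 + ν) ^ 2 * s ω) := by
    intro ω
    have e1 := norm_le_sqrt_mul_opNorm (T (M ω) (ζ ω))
    have e2 : opNorm (T (M ω) (ζ ω)) * (2 * (1 + ν))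
        ≤ opNorm (T (M ω) (ζ ω)) ^ 2 + (1 + ν) ^ 2 := by
      nlinarith [sq_nonneg (opNorm (T (M ω) (ζ ω)) - (1 + ν))]
    have e3 : √((min m n : ℕ) : ℝ) = a * (2 * (1 + ν)) := by rw [ha]; field_simp
    have e4 : ‖T (M ω) (ζ ω)‖ ≤ a * (opNorm (T (M ω) (ζ ω)) ^ 2 + (1 + ν) ^ 2) := by
      refine e1.trans ?_
      rw [e3, mul_assoc, mul_comm (2 * (1 + ν))]
      exact mul_le_mul_of_nonneg_left e2 ha0
    calc _ ≤ s ω * (a * (opNorm (T (M ω) (ζ ω)) ^ 2 + (1 + ν) ^ 2)) :=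
          mul_le_mul_of_nonneg_left e4 (hs0 ω)
      _ = _ := by ring
  have hI : Integrable (fun ω => a * (s ω * opNorm (T (M ω) (ζ ω)) ^ 2 + (1 + ν) ^ 2 * s ω)) μ :=
    (h1.add (hsi.const_mul _)).const_mul a
  have hI' : Integrable (fun ω => s ω * ‖T (M ω) (ζ ω)‖) μ :=
    hI.mono' (hsi.aestronglyMeasurable.mul hD.norm.aestronglyMeasurable) (ae_of_all _ fun ω => by
      rw [Real.norm_of_nonneg (mul_nonneg (hs0 ω) (norm_nonneg _))]
      exact hpt ω)
  refine ⟨hI', (integral_mono hI' hI hpt).trans ?_⟩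
  rw [integral_const_mul, integral_add h1 (hsi.const_mul _), integral_const_mul]
  calc _ ≤ a * ((1 + ν) ^ 2 * ∫ ω, s ω ∂μ + (1 + ν) ^ 2 * ∫ ω, s ω ∂μ) :=
        mul_le_mul_of_nonneg_left (by linarith) ha0
    _ = _ := by rw [ha]; field_simp; ring

end Polar

/-! ### The momentum error -/

/-- The momentum error `S_k = (1 - β) M_k - ∇f(X_k)`. -/
noncomputable def momentumError {m n B : ℕ} {Ω : Type*} (β : ℝ) (f : Mat m n → ℝ)
    (X : ℕ → Ω → Mat m n) (Cinit : Mat m n) (G : ℕ → Fin B → Ω → Mat m n) (k : ℕ) (ω : Ω) :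
    Mat m n :=
  (1 - β) • nesterov β Cinit G k ω - ∇ f (X k ω)

theorem momentumError_succ {m n B : ℕ} {Ω : Type*} (β : ℝ) (f : Mat m n → ℝ)
    (X : ℕ → Ω → Mat m n) (Cinit : Mat m n) (G : ℕ → Fin B → Ω → Mat m n) (k : ℕ) (ω : Ω) :
    momentumError β f X Cinit G (k + 1) ω = β • momentumError β f X Cinit G k ω
      + β ^ 2 • (∇ f (X k ω) - ∇ f (X (k + 1) ω))
      + ((1 - β ^ 2) • batchNoise f X G (k + 1) ω - (β * (1 - β)) • batchNoise f X G k ω) := by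
  simp only [momentumError, nesterov, momentum, batchNoise]
  module

/-- The weight of the noise of iteration `j` in the momentum error of iteration `k`. Nesterov's
extra gradient gives the newest noise the weight `1 - β ^ 2`; one iteration later part of it is
taken back. -/
noncomputable def noiseWeight (β : ℝ) : ℕ → ℕ → ℝ
  | 0, _ => 0
  | k + 1, j => β * noiseWeight β k j + (if j = k + 1 then 1 - β ^ 2 else 0)
      - (if j = k then β * (1 - β) else 0)

theorem noiseWeight_of_lt (β : ℝ) {k j : ℕ} (h : k < j) : noiseWeight β k j = 0 := by
  induction k with
  | zero => rfl
  | succ k ih =>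
    rw [noiseWeight, ih (by omega), if_neg (by omega), if_neg (by omega)]
    ring

theorem noiseWeight_self {β : ℝ} (k : ℕ) :
    noiseWeight β k k = 0 ∨ noiseWeight β k k = 1 - β ^ 2 := by
  cases k with
  | zero => exact Or.inl rfl
  | succ k =>
    right
    rw [noiseWeight, noiseWeight_of_lt β k.lt_succ_self, if_pos rfl, if_neg (by omega)]
    ring

theorem abs_noiseWeight_le {β : ℝ} (h0 : 0 < β) (h1 : β < 1) {k j : ℕ} (h : j ≤ k) :
    |noiseWeight β k j| ≤ 2 * (1 - β) * β ^ (k - j) := by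
  induction k with
  | zero => simp only [noiseWeight, abs_zero]; have := pow_pos h0 (0 - j); nlinarith
  | succ k ih =>
    rcases h.eq_or_lt with rfl | h
    · rw [Nat.sub_self, pow_zero, mul_one]
      rcases noiseWeight_self (β := β) (k + 1) with e | e
      · rw [e, abs_zero]; linarith
      · rw [e, abs_of_nonneg (by nlinarith)]; nlinarith
    rcases (Nat.lt_succ_iff.1 h).eq_or_lt with rfl | h
    · have hp : 0 < β * (1 - β) := mul_pos h0 (by linarith)
      rw [noiseWeight, if_neg (by omega), if_pos rfl, Nat.add_sub_cancel_left, pow_one, add_zero,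
        abs_le]
      rcases noiseWeight_self (β := β) j with e | e
      · rw [e]; constructor <;> nlinarith
      · rw [e]
        have : 0 < β * (1 - β) * β := mul_pos hp h0
        constructor <;> nlinarith
    · rw [noiseWeight, if_neg (by omega), if_neg (by omega), add_zero, sub_zero, abs_mul,
        abs_of_pos h0, Nat.succ_sub h.le, pow_succ]
      have := mul_le_mul_of_nonneg_left (ih h.le) h0.le
      linarith

theorem sum_noiseWeight_succ {E : Type*} [AddCommGroup E] [Module ℝ E] (β : ℝ) (ξ : ℕ → E)
    (k : ℕ) :
    ∑ j ∈ Finset.range (k + 2), noiseWeight β (k + 1) j • ξ j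
      = β • ∑ j ∈ Finset.range (k + 1), noiseWeight β k j • ξ j
        + ((1 - β ^ 2) • ξ (k + 1) - (β * (1 - β)) • ξ k) := by
  have h1 : ∀ j, noiseWeight β (k + 1) j • ξ j = β • (noiseWeight β k j • ξ j)
      + ((if j = k + 1 then (1 - β ^ 2) • ξ j else 0)
        - (if j = k then (β * (1 - β)) • ξ j else 0)) := fun j => by
    rw [noiseWeight]
    split_ifs <;> module
  simp only [h1, Finset.sum_add_distrib, Finset.sum_sub_distrib]
  rw [← Finset.smul_sum, Finset.sum_range_succ _ (k + 1), noiseWeight_of_lt β k.lt_succ_self,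
    Finset.sum_ite_eq' _ (k + 1), Finset.sum_ite_eq' _ k, if_pos (by simp), if_pos (by simp)]
  simp

theorem sum_pow_sub_le {β : ℝ} (h0 : 0 < β) (h1 : β < 1) (k : ℕ) :
    ∑ j ∈ Finset.range (k + 1), β ^ (k - j) ≤ 1 / (1 - β) := by
  have e : ∑ j ∈ Finset.range (k + 1), β ^ (k - j) = ∑ i ∈ Finset.range (k + 1), β ^ i :=
    Finset.sum_range_reflect (fun i => β ^ i) (k + 1)
  have hb : 0 < 1 - β := by linarith
  have := pow_pos h0 (k + 1)
  rw [e, le_div_iff₀ hb, geom_sum_mul_neg]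
  linarith

/-- The `ℓ^α` size of the weights: averaging over a window of length `1 / (1 - β)` gains the factor
`(1 - β) ^ ((α - 1) / α)`. -/
theorem sum_noiseWeight_rpow_le {α β : ℝ} (hα : 1 < α) (h0 : 0 < β) (h1 : β < 1) (k : ℕ) :
    (∑ j ∈ Finset.range (k + 1), |noiseWeight β k j| ^ α) ^ (1 / α)
      ≤ 2 * (1 - β) ^ ((α - 1) / α) := by
  have hα₀ : 0 < α := by linarith
  have hb : 0 < 1 - β := by linarith
  have hsum : ∑ j ∈ Finset.range (k + 1), |noiseWeight β k j| ^ α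
      ≤ 2 ^ α * (1 - β) ^ (α - 1) := by
    calc _ ≤ ∑ j ∈ Finset.range (k + 1), (2 * (1 - β)) ^ α * β ^ (k - j) := by
          refine Finset.sum_le_sum fun j hj => ?_
          have hjk : j ≤ k := Nat.lt_succ_iff.1 (Finset.mem_range.1 hj)
          refine (Real.rpow_le_rpow (abs_nonneg _) (abs_noiseWeight_le h0 h1 hjk) hα₀.le).trans ?_
          rw [Real.mul_rpow (by positivity) (by positivity)]
          refine mul_le_mul_of_nonneg_left ?_ (by positivity)
          have hp1 : β ^ (k - j) ≤ 1 := pow_le_one₀ h0.le h1.le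
          calc (β ^ (k - j)) ^ α ≤ (β ^ (k - j)) ^ (1 : ℝ) :=
                Real.rpow_le_rpow_of_exponent_ge (by positivity) hp1 hα.le
            _ = _ := Real.rpow_one _
      _ = (2 * (1 - β)) ^ α * ∑ j ∈ Finset.range (k + 1), β ^ (k - j) := by
          rw [Finset.mul_sum]
      _ ≤ (2 * (1 - β)) ^ α * (1 / (1 - β)) :=
          mul_le_mul_of_nonneg_left (sum_pow_sub_le h0 h1 k) (by positivity)
      _ = _ := by
          rw [Real.mul_rpow (by norm_num) hb.le, Real.rpow_sub hb, Real.rpow_one]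
          ring
  refine (Real.rpow_le_rpow (Finset.sum_nonneg fun j _ => Real.rpow_nonneg (abs_nonneg _) _) hsum
    (by positivity)).trans (le_of_eq ?_)
  rw [Real.mul_rpow (by positivity) (by positivity), ← Real.rpow_mul (by norm_num),
    ← Real.rpow_mul hb.le, mul_one_div_cancel hα₀.ne', Real.rpow_one, mul_one_div]

/-- Each noise term has total weight at most `2` over the whole run. -/
theorem sum_sum_noiseWeight_le {β : ℝ} (h0 : 0 < β) (h1 : β < 1) {e : ℕ → ℝ} (he : ∀ j, 0 ≤ e j)
    (K : ℕ) :
    ∑ k ∈ Finset.range K, ∑ j ∈ Finset.range (k + 1), |noiseWeight β k j| * e j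
      ≤ 2 * ∑ j ∈ Finset.range K, e j := by
  -- the geometric averages `t k` satisfy `t (k + 1) = β t k + e (k + 1)`
  set t : ℕ → ℝ := fun k => ∑ j ∈ Finset.range (k + 1), β ^ (k - j) * e j with ht
  have ht0 : ∀ k, 0 ≤ t k := fun k =>
    Finset.sum_nonneg fun j _ => mul_nonneg (pow_nonneg h0.le _) (he j)
  have hts : ∀ k, t (k + 1) = β * t k + e (k + 1) := fun k => by
    simp only [ht]
    rw [Finset.sum_range_succ _ (k + 1), Finset.mul_sum, Nat.sub_self, pow_zero, one_mul]
    congr 1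
    refine Finset.sum_congr rfl fun j hj => ?_
    rw [Nat.succ_sub (Nat.lt_succ_iff.1 (Finset.mem_range.1 hj)), pow_succ]
    ring
  have hsum : ∀ N, (1 - β) * ∑ k ∈ Finset.range (N + 1), t k + β * t N
      = ∑ k ∈ Finset.range (N + 1), e k := by
    intro N
    induction N with
    | zero => simp only [ht, zero_add, Finset.sum_range_one, pow_zero, Nat.sub_self]; ring
    | succ N ih =>
      rw [Finset.sum_range_succ _ (N + 1), Finset.sum_range_succ _ (N + 1), ← ih, hts]
      ring
  have hle : (1 - β) * ∑ k ∈ Finset.range K, t k ≤ ∑ k ∈ Finset.range K, e k := by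
    cases K with
    | zero => simp
    | succ N => have := hsum N; have := mul_nonneg h0.le (ht0 N); linarith
  calc _ ≤ ∑ k ∈ Finset.range K, 2 * (1 - β) * t k := by
        refine Finset.sum_le_sum fun k _ => ?_
        simp only [ht]
        rw [Finset.mul_sum]
        refine Finset.sum_le_sum fun j hj => ?_
        have := mul_le_mul_of_nonneg_right
          (abs_noiseWeight_le h0 h1 (Nat.lt_succ_iff.1 (Finset.mem_range.1 hj))) (he j)
        linarith
    _ = 2 * ((1 - β) * ∑ k ∈ Finset.range K, t k) := by rw [← Finset.mul_sum]; ring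
    _ ≤ _ := by linarith

/-! ### The run of the algorithm -/

/-- The standing assumptions on a run of Muon, with one inexactness level `γ` and `ν` for all
iterations. -/
structure MuonRun {m n B : ℕ} {Ω Z : Type*} [mΩ : MeasurableSpace Ω] [MeasurableSpace Z]
    (μ : Measure Ω) (ℱ : Filtration ℕ mΩ) (K : ℕ) (f : Mat m n → ℝ) (X₀ Cinit : Mat m n)
    (G : ℕ → Fin B → Ω → Mat m n) (T : ℕ → Mat m n → Z → Mat m n) (ζ : ℕ → Ω → Z)
    (fstar α σ₀ σ₁ L η β γ ν : ℝ) : Prop where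
  one_lt : 1 < α
  le_two : α ≤ 2
  batch_pos : 0 < B
  step_pos : 0 < η
  beta_pos : 0 < β
  beta_lt : β < 1
  L_nonneg : 0 ≤ L
  sigma0_nonneg : 0 ≤ σ₀
  sigma1_nonneg : 0 ≤ σ₁
  gamma_nonneg : 0 ≤ γ
  gamma_lt : γ < 1
  nu_nonneg : 0 ≤ ν
  lower : ∀ X, fstar ≤ f X
  smooth : LSmooth f L
  adapted : Adapted ℱ K G ζ
  measurable_routine : ∀ k < K, Measurable (Function.uncurry (T k))
  fresh : FreshSeeds μ ℱ K G ζ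
  noise : HeavyTailedNoise μ ℱ K f (iterate η β X₀ Cinit G T ζ) G α σ₀ σ₁
  polar : InexactPolar μ K (nesterov β Cinit G) (polarStep β Cinit G T ζ) (fun _ => γ) fun _ => ν

namespace MuonRun

variable {m n B : ℕ} {Ω Z : Type*} [mΩ : MeasurableSpace Ω] [MeasurableSpace Z]
  {μ : Measure Ω} {ℱ : Filtration ℕ mΩ} {K : ℕ} {f : Mat m n → ℝ} {X₀ Cinit : Mat m n}
  {G : ℕ → Fin B → Ω → Mat m n} {T : ℕ → Mat m n → Z → Mat m n} {ζ : ℕ → Ω → Z}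
  {fstar α σ₀ σ₁ L η β γ ν : ℝ}

theorem continuous_gradient (h : MuonRun μ ℱ K f X₀ Cinit G T ζ fstar α σ₀ σ₁ L η β γ ν) :
    Continuous (∇ f) := by
  refine (LipschitzWith.of_dist_le_mul (K := ⟨L, h.L_nonneg⟩) fun X Y => ?_).continuous
  rw [dist_eq_norm, dist_eq_norm]
  exact h.smooth.gradient_lipschitz X Y

theorem measurable_momentum (h : MuonRun μ ℱ K f X₀ Cinit G T ζ fstar α σ₀ σ₁ L η β γ ν)
    {k : ℕ} (hk : k < K) : Measurable[ℱ (k + 1)] (momentum β Cinit G k) := by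
  have hb : ∀ j < K, Measurable[ℱ (j + 1)] (batchGrad G j) := fun j hj =>
    Measurable.const_smul (g := fun ω => ∑ i, G j i ω)
      (Finset.measurable_fun_sum _ fun i _ => h.adapted.grad j hj i) (1 / (B : ℝ))
  induction k with
  | zero => exact measurable_const.add (hb 0 hk)
  | succ k ih =>
    have hk' : k < K := by omega
    exact (((ih hk').mono (ℱ.mono k.succ.le_succ) le_rfl).const_smul β).add (hb _ hk)

/-- All that is known when the seed of iteration `k` is drawn. -/
abbrev past (ℱ : Filtration ℕ mΩ) (G : ℕ → Fin B → Ω → Mat m n) (k : ℕ) : MeasurableSpace Ω :=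
  ℱ k ⊔ ⨆ i, MeasurableSpace.comap (G k i) inferInstance

theorem past_le (h : MuonRun μ ℱ K f X₀ Cinit G T ζ fstar α σ₀ σ₁ L η β γ ν)
    {k : ℕ} (hk : k < K) : past ℱ G k ≤ mΩ :=
  sup_le (ℱ.le k) (iSup_le fun i => ((h.adapted.grad k hk i).mono (ℱ.le _) le_rfl).comap_le)

theorem measurable_nesterov_past (h : MuonRun μ ℱ K f X₀ Cinit G T ζ fstar α σ₀ σ₁ L η β γ ν)
    {k : ℕ} (hk : k < K) : Measurable[past ℱ G k] (nesterov β Cinit G k) := by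
  have hG : ∀ i, Measurable[past ℱ G k] (G k i) := fun i => by
    rw [measurable_iff_comap_le]
    exact le_sup_of_le_right
      (le_iSup (fun i => MeasurableSpace.comap (G k i) inferInstance) i)
  have hb : Measurable[past ℱ G k] (batchGrad G k) :=
    Measurable.const_smul (g := fun ω => ∑ i, G k i ω)
      (Finset.measurable_fun_sum _ fun i _ => hG i) (1 / (B : ℝ))
  have hC : Measurable[past ℱ G k] (momentum β Cinit G k) := by
    cases k with
    | zero => exact measurable_const.add hb
    | succ k =>
      exact (((h.measurable_momentum (by omega)).mono le_sup_left le_rfl).const_smul β).add hb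
  exact (hC.const_smul β).add hb

theorem measurable_nesterov (h : MuonRun μ ℱ K f X₀ Cinit G T ζ fstar α σ₀ σ₁ L η β γ ν)
    {k : ℕ} (hk : k < K) : Measurable[ℱ (k + 1)] (nesterov β Cinit G k) :=
  (h.measurable_nesterov_past hk).mono (sup_le (ℱ.mono k.le_succ)
    (iSup_le fun i => (h.adapted.grad k hk i).comap_le)) le_rfl

theorem measurable_polarStep (h : MuonRun μ ℱ K f X₀ Cinit G T ζ fstar α σ₀ σ₁ L η β γ ν)
    {k : ℕ} (hk : k < K) : Measurable[ℱ (k + 1)] (polarStep β Cinit G T ζ k) :=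
  (h.measurable_routine k hk).comp ((h.measurable_nesterov hk).prodMk (h.adapted.seed k hk))

theorem measurable_iterate (h : MuonRun μ ℱ K f X₀ Cinit G T ζ fstar α σ₀ σ₁ L η β γ ν)
    {k : ℕ} (hk : k ≤ K) : Measurable[ℱ k] (iterate η β X₀ Cinit G T ζ k) := by
  induction k with
  | zero => exact measurable_const
  | succ k ih =>
    exact ((ih (by omega)).mono (ℱ.mono k.le_succ) le_rfl).sub
      ((h.measurable_polarStep hk).const_smul η)

theorem measurable_gradient (h : MuonRun μ ℱ K f X₀ Cinit G T ζ fstar α σ₀ σ₁ L η β γ ν)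
    {k : ℕ} (hk : k ≤ K) : Measurable[ℱ k] fun ω => ∇ f (iterate η β X₀ Cinit G T ζ k ω) :=
  h.continuous_gradient.measurable.comp (h.measurable_iterate hk)

theorem measurable_momentumError_past
    (h : MuonRun μ ℱ K f X₀ Cinit G T ζ fstar α σ₀ σ₁ L η β γ ν) {k : ℕ} (hk : k < K) :
    Measurable[past ℱ G k] (momentumError β f (iterate η β X₀ Cinit G T ζ) Cinit G k) :=
  ((h.measurable_nesterov_past hk).const_smul (1 - β)).sub
    ((h.measurable_gradient hk.le).mono le_sup_left le_rfl)

theorem integrable_gradient (h : MuonRun μ ℱ K f X₀ Cinit G T ζ fstar α σ₀ σ₁ L η β γ ν)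
    {k : ℕ} (hk : k < K) : Integrable (fun ω => ∇ f (iterate η β X₀ Cinit G T ζ k ω)) μ :=
  h.noise.integrable_gradient h.batch_pos hk

variable [IsProbabilityMeasure μ]

theorem integrable_nesterov (h : MuonRun μ ℱ K f X₀ Cinit G T ζ fstar α σ₀ σ₁ L η β γ ν)
    {k : ℕ} (hk : k < K) : Integrable (nesterov β Cinit G k) μ := by
  have hb : ∀ j < K, Integrable (batchGrad G j) μ := fun j hj =>
    (integrable_finsetSum Finset.univ fun i _ => h.noise.integrable j hj i).smul (1 / (B : ℝ))
  have hC : ∀ j < K, Integrable (momentum β Cinit G j) μ := by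
    intro j hj
    induction j with
    | zero => exact (integrable_const _).add (hb 0 hj)
    | succ j ih => exact ((ih (by omega)).smul β).add (hb _ hj)
  exact ((hC k hk).smul β).add (hb k hk)

theorem integrable_momentumError (h : MuonRun μ ℱ K f X₀ Cinit G T ζ fstar α σ₀ σ₁ L η β γ ν)
    {k : ℕ} (hk : k < K) :
    Integrable (momentumError β f (iterate η β X₀ Cinit G T ζ) Cinit G k) μ :=
  ((h.integrable_nesterov hk).smul (1 - β)).sub (h.integrable_gradient hk)

/-! ### Moments of the computed directions -/

theorem integral_mul_norm_polarStep_le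
    (h : MuonRun μ ℱ K f X₀ Cinit G T ζ fstar α σ₀ σ₁ L η β γ ν) {k : ℕ} (hk : k < K)
    {s : Ω → ℝ} (hs : Measurable[past ℱ G k] s) (hs0 : ∀ ω, 0 ≤ s ω) (hsi : Integrable s μ) :
    Integrable (fun ω => s ω * ‖polarStep β Cinit G T ζ k ω‖) μ ∧
      ∫ ω, s ω * ‖polarStep β Cinit G T ζ k ω‖ ∂μ
        ≤ √((min m n : ℕ) : ℝ) * (1 + ν) * ∫ ω, s ω ∂μ :=
  integral_mul_norm_le (h.past_le hk) (h.measurable_nesterov_past hk)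
    ((h.adapted.seed k hk).mono (ℱ.le _) le_rfl) (h.fresh k hk) (h.measurable_routine k hk)
    (h.polar.integrable_opNorm k hk) h.nu_nonneg (h.polar.feasibility k hk) hs hs0 hsi

theorem integral_norm_polarStep_le
    (h : MuonRun μ ℱ K f X₀ Cinit G T ζ fstar α σ₀ σ₁ L η β γ ν) {k : ℕ} (hk : k < K) :
    Integrable (fun ω => ‖polarStep β Cinit G T ζ k ω‖) μ ∧
      ∫ ω, ‖polarStep β Cinit G T ζ k ω‖ ∂μ ≤ √((min m n : ℕ) : ℝ) * (1 + ν) := by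
  simpa using h.integral_mul_norm_polarStep_le hk (s := fun _ => 1) measurable_const
    (fun _ => zero_le_one) (integrable_const _)

theorem integral_norm_sq_polarStep_le
    (h : MuonRun μ ℱ K f X₀ Cinit G T ζ fstar α σ₀ σ₁ L η β γ ν) {k : ℕ} (hk : k < K) :
    Integrable (fun ω => ‖polarStep β Cinit G T ζ k ω‖ ^ 2) μ ∧
      ∫ ω, ‖polarStep β Cinit G T ζ k ω‖ ^ 2 ∂μ ≤ (min m n : ℕ) * (1 + ν) ^ 2 := by
  have hop := h.polar.integrable_opNorm k hk
  have hpt : ∀ ω, ‖polarStep β Cinit G T ζ k ω‖ ^ 2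
      ≤ (min m n : ℕ) * opNorm (polarStep β Cinit G T ζ k ω) ^ 2 := fun ω => by
    have := pow_le_pow_left₀ (norm_nonneg _)
      (norm_le_sqrt_mul_opNorm (polarStep β Cinit G T ζ k ω)) 2
    rwa [mul_pow, Real.sq_sqrt (Nat.cast_nonneg _)] at this
  have hI : Integrable (fun ω => ‖polarStep β Cinit G T ζ k ω‖ ^ 2) μ :=
    (hop.const_mul _).mono' ((((h.measurable_polarStep hk).mono (ℱ.le _) le_rfl).norm.pow_const
      2).aestronglyMeasurable) (ae_of_all _ fun ω => by
        rw [Real.norm_of_nonneg (by positivity)]; exact hpt ω)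
  refine ⟨hI, (integral_mono hI (hop.const_mul _) hpt).trans ?_⟩
  rw [integral_const_mul]
  refine mul_le_mul_of_nonneg_left ?_ (Nat.cast_nonneg _)
  have hM : Measurable (nesterov β Cinit G k) := (h.measurable_nesterov hk).mono (ℱ.le _) le_rfl
  rw [← integral_condExp hM.comap_le]
  exact (integral_mono_ae integrable_condExp (integrable_const _)
    (h.polar.feasibility k hk)).trans (by simp)

/-- The direction is aligned with the momentum, measured in the Frobenius norm, which the nuclear
norm dominates. -/
theorem mul_integral_norm_nesterov_le
    (h : MuonRun μ ℱ K f X₀ Cinit G T ζ fstar α σ₀ σ₁ L η β γ ν) {k : ℕ} (hk : k < K) :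
    (1 - γ) * ∫ ω, ‖nesterov β Cinit G k ω‖ ∂μ
      ≤ ∫ ω, ⟪nesterov β Cinit G k ω, polarStep β Cinit G T ζ k ω⟫_ℝ ∂μ := by
  have hM : Measurable (nesterov β Cinit G k) := (h.measurable_nesterov hk).mono (ℱ.le _) le_rfl
  rw [← integral_condExp hM.comap_le
    (f := fun ω => ⟪nesterov β Cinit G k ω, polarStep β Cinit G T ζ k ω⟫_ℝ), ← integral_const_mul]
  refine integral_mono_ae ((h.integrable_nesterov hk).norm.const_mul _) integrable_condExp ?_
  filter_upwards [h.polar.alignment k hk] with ω hω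
  exact (mul_le_mul_of_nonneg_left (norm_le_nuclearNorm _) (by linarith [h.gamma_lt])).trans hω

/-! ### Expected momentum error -/

/-- The part of the momentum error that is not noise contracts by `β`, up to the drift of the
gradient. -/
theorem integral_norm_momentumError_sub_noise_le
    (h : MuonRun μ ℱ K f X₀ Cinit G T ζ fstar α σ₀ σ₁ L η β γ ν) {k : ℕ} (hk : k < K) :
    ∫ ω, ‖momentumError β f (iterate η β X₀ Cinit G T ζ) Cinit G k ω
        - ∑ j ∈ Finset.range (k + 1),
          noiseWeight β k j • batchNoise f (iterate η β X₀ Cinit G T ζ) G j ω‖ ∂μ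
      ≤ β ^ k * ∫ ω, ‖momentumError β f (iterate η β X₀ Cinit G T ζ) Cinit G 0 ω‖ ∂μ
        + β ^ 2 * (L * η * (√((min m n : ℕ) : ℝ) * (1 + ν))) / (1 - β) := by
  have hβ := h.beta_pos
  have hb : 0 < 1 - β := by linarith [h.beta_lt]
  have hη := h.step_pos
  have hL := h.L_nonneg
  have hν := h.nu_nonneg
  set X := iterate η β X₀ Cinit G T ζ with hX
  set d := √((min m n : ℕ) : ℝ) * (1 + ν)
  set c := β ^ 2 * (L * η * d) with hc
  set R : ℕ → Ω → Mat m n := fun k ω => momentumError β f X Cinit G k ω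
    - ∑ j ∈ Finset.range (k + 1), noiseWeight β k j • batchNoise f X G j ω with hR
  have hRi : ∀ j < K, Integrable (R j) μ := fun j hj =>
    (h.integrable_momentumError hj).sub (integrable_finsetSum _ fun i hi =>
      (h.noise.integrable_batchNoise h.one_lt h.batch_pos
        ((Nat.lt_succ_iff.1 (Finset.mem_range.1 hi)).trans_lt hj)).smul (noiseWeight β j i))
  change ∫ ω, ‖R k ω‖ ∂μ ≤ _
  induction k with
  | zero =>
    have : ∀ ω, R 0 ω = momentumError β f X Cinit G 0 ω := fun ω => by
      simp [hR, noiseWeight]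
    simp only [this, pow_zero, one_mul]
    have : 0 ≤ c / (1 - β) := by positivity
    linarith
  | succ k ih =>
    have hk' : k < K := by omega
    have hpt : ∀ ω, ‖R (k + 1) ω‖ ≤ β * ‖R k ω‖
        + β ^ 2 * (L * η) * ‖polarStep β Cinit G T ζ k ω‖ := by
      intro ω
      have e : R (k + 1) ω = β • R k ω + β ^ 2 • (∇ f (X k ω) - ∇ f (X (k + 1) ω)) := by
        simp only [hR]
        rw [momentumError_succ, sum_noiseWeight_succ β (fun j => batchNoise f X G j ω) k]
        module
      have hdiff : ‖∇ f (X k ω) - ∇ f (X (k + 1) ω)‖ ≤ L * (η * ‖polarStep β Cinit G T ζ k ω‖) := by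
        refine (h.smooth.gradient_lipschitz _ _).trans (le_of_eq ?_)
        rw [hX, iterate, sub_sub_cancel, norm_smul, Real.norm_of_nonneg hη.le]
      rw [e]
      refine (norm_add_le _ _).trans ?_
      rw [norm_smul, norm_smul, Real.norm_of_nonneg hβ.le, Real.norm_of_nonneg (sq_nonneg β)]
      have := mul_le_mul_of_nonneg_left hdiff (sq_nonneg β)
      linarith
    obtain ⟨hDi, hD⟩ := h.integral_norm_polarStep_le hk'
    have h1 : ∫ ω, ‖R (k + 1) ω‖ ∂μ ≤ β * ∫ ω, ‖R k ω‖ ∂μ + c := by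
      refine (integral_mono (hRi _ hk).norm
        (((hRi k hk').norm.const_mul β).add (hDi.const_mul _)) hpt).trans ?_
      rw [integral_add' ((hRi k hk').norm.const_mul β) (hDi.const_mul _), integral_const_mul,
        integral_const_mul]
      have := mul_le_mul_of_nonneg_left hD (by positivity : 0 ≤ β ^ 2 * (L * η))
      rw [hc]
      linarith
    have h2 := mul_le_mul_of_nonneg_left (ih hk') hβ.le
    have h3 : β * (c / (1 - β)) + c = c / (1 - β) := by field_simp; ring
    rw [pow_succ]
    linarith

/-- Expected momentum error, summed over the run. -/
theorem sum_integral_norm_momentumError_le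
    (h : MuonRun μ ℱ K f X₀ Cinit G T ζ fstar α σ₀ σ₁ L η β γ ν) :
    ∑ k ∈ Finset.range K,
        ∫ ω, ‖momentumError β f (iterate η β X₀ Cinit G T ζ) Cinit G k ω‖ ∂μ
      ≤ (∫ ω, ‖initialError β f X₀ Cinit G ω‖ ∂μ) / (1 - β)
        + K * (β ^ 2 * (L * η * (√((min m n : ℕ) : ℝ) * (1 + ν))) / (1 - β))
        + noiseScale α B * (K * (σ₀ * (2 * (1 - β) ^ ((α - 1) / α)))
          + σ₁ * (2 * ∑ k ∈ Finset.range K,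
            ∫ ω, ‖∇ f (iterate η β X₀ Cinit G T ζ k ω)‖ ∂μ)) := by
  have hβ := h.beta_pos
  have hb : 0 < 1 - β := by linarith [h.beta_lt]
  set X := iterate η β X₀ Cinit G T ζ with hX
  set c := β ^ 2 * (L * η * (√((min m n : ℕ) : ℝ) * (1 + ν))) / (1 - β)
  set e : ℕ → ℝ := fun k => ∫ ω, ‖∇ f (X k ω)‖ ∂μ with he
  have he0 : ∀ k, 0 ≤ e k := fun k => integral_nonneg fun _ => norm_nonneg _
  set N : ℕ → Ω → Mat m n := fun k ω =>
    ∑ j ∈ Finset.range (k + 1), noiseWeight β k j • batchNoise f X G j ω with hN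
  have hstep : ∀ k ∈ Finset.range K, ∫ ω, ‖momentumError β f X Cinit G k ω‖ ∂μ
      ≤ β ^ k * (∫ ω, ‖initialError β f X₀ Cinit G ω‖ ∂μ) + c
        + noiseScale α B * (σ₀ * (2 * (1 - β) ^ ((α - 1) / α))
          + σ₁ * ∑ j ∈ Finset.range (k + 1), |noiseWeight β k j| * e j) := by
    intro k hk
    have hkK := Finset.mem_range.1 hk
    have hNi : Integrable (N k) μ := integrable_finsetSum _ fun i hi =>
      (h.noise.integrable_batchNoise h.one_lt h.batch_pos
        ((Nat.lt_succ_iff.1 (Finset.mem_range.1 hi)).trans_lt hkK)).smul (noiseWeight β k i)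
    have hSi := h.integrable_momentumError hkK
    have h1 := h.integral_norm_momentumError_sub_noise_le hkK
    have h2 := h.noise.integral_norm_sum_le h.one_lt h.le_two h.batch_pos h.sigma0_nonneg
      h.sigma1_nonneg h.continuous_gradient.measurable
      (fun k hk => h.measurable_iterate hk.le) h.adapted.grad (noiseWeight β k)
      (Nat.succ_le_of_lt hkK)
    have h3 : ∫ ω, ‖momentumError β f X Cinit G k ω‖ ∂μ
        ≤ ∫ ω, ‖momentumError β f X Cinit G k ω - N k ω‖ ∂μ + ∫ ω, ‖N k ω‖ ∂μ := by
      have hdi : Integrable (fun ω => ‖momentumError β f X Cinit G k ω - N k ω‖) μ :=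
        (hSi.sub hNi).norm
      rw [← integral_add hdi hNi.norm]
      refine integral_mono hSi.norm (hdi.add hNi.norm) fun ω => ?_
      simpa using norm_add_le (momentumError β f X Cinit G k ω - N k ω) (N k ω)
    have h4 := mul_le_mul_of_nonneg_left (add_le_add_left
      (mul_le_mul_of_nonneg_left (sum_noiseWeight_rpow_le h.one_lt hβ h.beta_lt k)
        h.sigma0_nonneg) (σ₁ * ∑ j ∈ Finset.range (k + 1), |noiseWeight β k j| * e j))
      (noiseScale_nonneg α B)
    exact h3.trans (add_le_add h1 (h2.trans h4))
  refine (Finset.sum_le_sum hstep).trans ?_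
  rw [Finset.sum_add_distrib, Finset.sum_add_distrib, ← Finset.sum_mul, ← Finset.mul_sum,
    Finset.sum_add_distrib, ← Finset.mul_sum _ _ σ₁]
  simp only [Finset.sum_const, Finset.card_range, nsmul_eq_mul]
  have hgeom : (∑ k ∈ Finset.range K, β ^ k) * ∫ ω, ‖initialError β f X₀ Cinit G ω‖ ∂μ
      ≤ (∫ ω, ‖initialError β f X₀ Cinit G ω‖ ∂μ) / (1 - β) := by
    rw [le_div_iff₀ hb, mul_right_comm, geom_sum_mul_neg]
    have := mul_nonneg (pow_nonneg hβ.le K)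
      (integral_nonneg (μ := μ) fun ω => norm_nonneg (initialError β f X₀ Cinit G ω))
    linarith
  have hdouble := mul_le_mul_of_nonneg_left (mul_le_mul_of_nonneg_left
    (sum_sum_noiseWeight_le hβ h.beta_lt he0 K) h.sigma1_nonneg) (noiseScale_nonneg α B)
  linarith

/-! ### Descent -/

/-- Expected decrease of the objective in one iteration. -/
theorem integral_descent (h : MuonRun μ ℱ K f X₀ Cinit G T ζ fstar α σ₀ σ₁ L η β γ ν)
    {k : ℕ} (hk : k < K) (hfk : Integrable (fun ω => f (iterate η β X₀ Cinit G T ζ k ω)) μ) :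
    Integrable (fun ω => f (iterate η β X₀ Cinit G T ζ (k + 1) ω)) μ ∧
    ∫ ω, f (iterate η β X₀ Cinit G T ζ (k + 1) ω) ∂μ
      ≤ ∫ ω, f (iterate η β X₀ Cinit G T ζ k ω) ∂μ
        - η * ((1 - γ) * ∫ ω, ‖∇ f (iterate η β X₀ Cinit G T ζ k ω)‖ ∂μ
          - (1 + √((min m n : ℕ) : ℝ) * (1 + ν))
            * ∫ ω, ‖momentumError β f (iterate η β X₀ Cinit G T ζ) Cinit G k ω‖ ∂μ)
        + L * η ^ 2 * ((min m n : ℕ) * (1 + ν) ^ 2) := by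
  have hb : 0 < 1 - β := by linarith [h.beta_lt]
  have hη := h.step_pos
  have hL := h.L_nonneg
  have hγ : 0 ≤ 1 - γ := by linarith [h.gamma_lt]
  have hγ0 := h.gamma_nonneg
  set X := iterate η β X₀ Cinit G T ζ with hX
  set D := polarStep β Cinit G T ζ k with hD
  set M := nesterov β Cinit G k with hM
  set S := momentumError β f X Cinit G k with hS
  have hSi : Integrable S μ := h.integrable_momentumError hk
  have hgi := h.integrable_gradient hk
  have hMi : Integrable M μ := h.integrable_nesterov hk
  have hMD : Integrable (fun ω => ⟪M ω, D ω⟫_ℝ) μ := h.polar.integrable_inner k hk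
  obtain ⟨hSD, hSD'⟩ := h.integral_mul_norm_polarStep_le hk
    (s := fun ω => ‖S ω‖) (measurable_norm.comp (h.measurable_momentumError_past hk))
    (fun ω => norm_nonneg _) hSi.norm
  obtain ⟨hD2, hD2'⟩ := h.integral_norm_sq_polarStep_le hk
  have hpt : ∀ ω, f (X (k + 1) ω) ≤ f (X k ω)
      + (-(η * (1 - β)) * ⟪M ω, D ω⟫_ℝ + η * (‖S ω‖ * ‖D ω‖) + L * η ^ 2 * ‖D ω‖ ^ 2) := by
    intro ω
    have hdiff : X (k + 1) ω - X k ω = -(η • D ω) := by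
      rw [hX, iterate]; abel
    have h1 := le_add_inner_gradient_add hL h.smooth.differentiable h.smooth.gradient_lipschitz
      (X k ω) (X (k + 1) ω)
    rw [hdiff, norm_neg, norm_smul, Real.norm_of_nonneg hη.le, inner_neg_right,
      inner_smul_right] at h1
    have h2 : ∇ f (X k ω) = (1 - β) • M ω - S ω := by
      rw [hS, momentumError]; abel
    rw [h2, inner_sub_left, real_inner_smul_left] at h1
    have h3 := mul_le_mul_of_nonneg_left (real_inner_le_norm (S ω) (D ω)) hη.le
    linarith
  have i1 := hMD.const_mul (-(η * (1 - β)))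
  have i2 := hSD.const_mul η
  have i3 := hD2.const_mul (L * η ^ 2)
  have hI := hfk.add ((i1.add i2).add i3)
  have hfm : AEStronglyMeasurable (fun ω => f (X (k + 1) ω)) μ :=
    (h.smooth.differentiable.continuous.measurable.comp
      ((h.measurable_iterate (k := k + 1) hk).mono (ℱ.le _) le_rfl)).aestronglyMeasurable
  have hf' : Integrable (fun ω => f (X (k + 1) ω)) μ := by
    refine (hI.norm.add (integrable_const |fstar|)).mono' hfm (ae_of_all _ fun ω => ?_)
    have h1 := hpt ω
    have h2 := h.lower (X (k + 1) ω)
    rw [Real.norm_eq_abs, abs_le]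
    have h3 := neg_abs_le fstar
    have h4 := abs_nonneg fstar
    simp only [Pi.add_apply, Real.norm_eq_abs]
    have h5 := le_abs_self (f (X k ω)
      + (-(η * (1 - β)) * ⟪M ω, D ω⟫_ℝ + η * (‖S ω‖ * ‖D ω‖) + L * η ^ 2 * ‖D ω‖ ^ 2))
    have h6 := abs_nonneg (f (X k ω)
      + (-(η * (1 - β)) * ⟪M ω, D ω⟫_ℝ + η * (‖S ω‖ * ‖D ω‖) + L * η ^ 2 * ‖D ω‖ ^ 2))
    constructor <;> linarith
  refine ⟨hf', (integral_mono hf' hI hpt).trans ?_⟩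
  rw [integral_add' hfk ((i1.add i2).add i3), integral_add' (i1.add i2) i3, integral_add' i1 i2,
    integral_const_mul, integral_const_mul, integral_const_mul]
  have halign := h.mul_integral_norm_nesterov_le hk
  -- `(1 - β) ‖M‖ ≥ ‖∇f(X_k)‖ - ‖S‖`
  have htri : ∫ ω, ‖∇ f (X k ω)‖ ∂μ - ∫ ω, ‖S ω‖ ∂μ ≤ (1 - β) * ∫ ω, ‖M ω‖ ∂μ := by
    rw [← integral_sub hgi.norm hSi.norm, ← integral_const_mul]
    refine integral_mono (hgi.norm.sub hSi.norm) (hMi.norm.const_mul _) fun ω => ?_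
    have h2 : ∇ f (X k ω) = (1 - β) • M ω - S ω := by
      rw [hS, momentumError]; abel
    have h3 := norm_sub_le ((1 - β) • M ω) (S ω)
    rw [← h2, norm_smul, Real.norm_of_nonneg hb.le] at h3
    simp only
    linarith
  have hS0 : 0 ≤ ∫ ω, ‖S ω‖ ∂μ := integral_nonneg fun _ => norm_nonneg _
  have a1 := mul_le_mul_of_nonneg_left halign (mul_nonneg hη.le hb.le)
  have a2 := mul_le_mul_of_nonneg_left htri (mul_nonneg hη.le hγ)
  have a3 := mul_le_mul_of_nonneg_left hSD' hη.le
  have a4 := mul_le_mul_of_nonneg_left hD2' (by positivity : 0 ≤ L * η ^ 2)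
  have a5 := mul_nonneg (mul_nonneg hη.le hγ0) hS0
  linarith

/-- The descent inequalities summed over the run. -/
theorem sum_integral_gradient_le
    (h : MuonRun μ ℱ K f X₀ Cinit G T ζ fstar α σ₀ σ₁ L η β γ ν) :
    (1 - γ) * ∑ k ∈ Finset.range K, ∫ ω, ‖∇ f (iterate η β X₀ Cinit G T ζ k ω)‖ ∂μ
      ≤ (f X₀ - fstar) / η
        + (1 + √((min m n : ℕ) : ℝ) * (1 + ν)) * ∑ k ∈ Finset.range K,
          ∫ ω, ‖momentumError β f (iterate η β X₀ Cinit G T ζ) Cinit G k ω‖ ∂μ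
        + K * (L * η * ((min m n : ℕ) * (1 + ν) ^ 2)) := by
  have hη := h.step_pos
  set X := iterate η β X₀ Cinit G T ζ with hX
  have key : ∀ N ≤ K, Integrable (fun ω => f (X N ω)) μ ∧ ∫ ω, f (X N ω) ∂μ ≤ f X₀
      - η * ((1 - γ) * ∑ k ∈ Finset.range N, ∫ ω, ‖∇ f (X k ω)‖ ∂μ
        - (1 + √((min m n : ℕ) : ℝ) * (1 + ν)) * ∑ k ∈ Finset.range N,
          ∫ ω, ‖momentumError β f X Cinit G k ω‖ ∂μ)
      + N * (L * η ^ 2 * ((min m n : ℕ) * (1 + ν) ^ 2)) := by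
    intro N
    induction N with
    | zero =>
      intro _
      have : ∀ ω, X 0 ω = X₀ := fun ω => rfl
      simp [this]
    | succ N ih =>
      intro hN
      obtain ⟨h1, h2⟩ := ih (by omega)
      obtain ⟨h3, h4⟩ := h.integral_descent hN h1
      refine ⟨h3, ?_⟩
      rw [Finset.sum_range_succ, Finset.sum_range_succ]
      rw [Nat.cast_succ]
      linarith
  obtain ⟨h1, h2⟩ := key K le_rfl
  have h3 : fstar ≤ ∫ ω, f (X K ω) ∂μ := by
    simpa using integral_mono (integrable_const fstar) h1 (fun ω => h.lower (X K ω))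
  have h4 : η * ((1 - γ) * ∑ k ∈ Finset.range K, ∫ ω, ‖∇ f (X k ω)‖ ∂μ
      - (1 + √((min m n : ℕ) : ℝ) * (1 + ν)) * ∑ k ∈ Finset.range K,
          ∫ ω, ‖momentumError β f X Cinit G k ω‖ ∂μ
      - K * (L * η * ((min m n : ℕ) * (1 + ν) ^ 2))) ≤ f X₀ - fstar := by linarith
  have h5 := (le_div_iff₀' hη).2 h4
  linarith

end MuonRun

/-! ### Constants and rates -/

theorem noiseScale_eq (α : ℝ) {B : ℕ} (hB : 0 < B) :
    noiseScale α B = 2 ^ (1 / α) / (B : ℝ) ^ ((α - 1) / α) := by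
  have hB' : (0 : ℝ) < B := by exact_mod_cast hB
  have e : (1 - α) * (1 / α) = -((α - 1) / α) := by ring
  rw [noiseScale, Real.mul_rpow (by norm_num) (by positivity), ← Real.rpow_mul hB'.le, e,
    Real.rpow_neg hB'.le, ← div_eq_mul_inv]

theorem two_rpow_le {α : ℝ} (hα : 1 < α) : (2 : ℝ) ^ (1 / α) ≤ 2 := by
  calc (2 : ℝ) ^ (1 / α) ≤ 2 ^ (1 : ℝ) := Real.rpow_le_rpow_of_exponent_le (by norm_num)
        (by rw [div_le_one (by linarith)]; exact hα.le)
    _ = 2 := Real.rpow_one 2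

theorem one_le_batch_rpow {α : ℝ} (hα : 1 < α) {B : ℕ} (hB : 0 < B) :
    1 ≤ (B : ℝ) ^ ((α - 1) / α) :=
  Real.one_le_rpow (by exact_mod_cast hB) (div_nonneg (by linarith) (by linarith))

theorem noiseScale_le {α : ℝ} (hα : 1 < α) {B : ℕ} (hB : 0 < B) :
    noiseScale α B ≤ 2 / (B : ℝ) ^ ((α - 1) / α) := by
  rw [noiseScale_eq α hB]
  exact div_le_div_of_nonneg_right (two_rpow_le hα) (by positivity)

/-- A batch above the threshold makes `ρ` positive. -/
theorem rho_pos {α Cα : ℝ} (hα : 1 < α) (hC : 0 ≤ Cα) {d₀ B : ℕ} {σ₁ γ ν : ℝ} (hσ₁ : 0 ≤ σ₁)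
    (hγ : γ < 1) (hν : 0 ≤ ν) (hB : batchThreshold α Cα d₀ σ₁ γ ν < B) :
    0 < rho α Cα d₀ σ₁ γ ν B := by
  have hα' : 0 < α - 1 := by linarith
  have hα₀ : 0 < α := by linarith
  have hγ' : 0 < 1 - γ := by linarith
  rw [batchThreshold] at hB
  set x := 2 * √Real.pi * (1 + √(d₀ : ℝ) * (1 + ν)) * Cα ^ (1 / α) * σ₁ / (1 - γ) with hx
  have hx0 : 0 ≤ x := by positivity
  have hxB : x < (B : ℝ) ^ ((α - 1) / α) := by
    have h1 := Real.rpow_lt_rpow (by positivity) hB (by positivity : 0 < (α - 1) / α)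
    rwa [← Real.rpow_mul hx0, div_mul_div_cancel₀ hα'.ne', div_self hα₀.ne', Real.rpow_one] at h1
  have hb : 0 < (B : ℝ) ^ ((α - 1) / α) := hx0.trans_lt hxB
  rw [hx, div_lt_iff₀ hγ'] at hxB
  rw [rho, sub_pos, div_lt_iff₀ hb]
  linarith

theorem minUpTo_mul_le {K : ℕ} (a : ℕ → ℝ) :
    K * minUpTo K a ≤ ∑ k ∈ Finset.range K, a k := by
  calc (K : ℝ) * minUpTo K a = ∑ _k ∈ Finset.range K, minUpTo K a := by simp
    _ ≤ _ := Finset.sum_le_sum fun k hk =>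
        ciInf_le (Set.finite_range fun k : Fin K => a k).bddBelow ⟨k, Finset.mem_range.1 hk⟩

theorem le_maxUpTo {K k : ℕ} (hk : k < K) (a : ℕ → ℝ) : a k ≤ maxUpTo K a :=
  le_ciSup (Set.finite_range fun k : Fin K => a k).bddAbove ⟨k, hk⟩

theorem maxUpTo_lt {K : ℕ} (hK : 1 ≤ K) {a : ℕ → ℝ} {c : ℝ} (h : ∀ k < K, a k < c) :
    maxUpTo K a < c := by
  have : Nonempty (Fin K) := ⟨⟨0, hK⟩⟩
  obtain ⟨k, hk⟩ := exists_eq_ciSup_of_finite (f := fun k : Fin K => a k)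
  rw [maxUpTo, ← hk]
  exact h k k.2

/-- The inexactness levels may be replaced by their maxima. -/
theorem InexactPolar.maxUpTo {m n : ℕ} {Ω : Type*} [MeasurableSpace Ω] {μ : Measure Ω} {K : ℕ}
    {M D : ℕ → Ω → Mat m n} {γ ν : ℕ → ℝ} (h : InexactPolar μ K M D γ ν) :
    InexactPolar μ K M D (fun _ => maxUpTo K γ) fun _ => maxUpTo K ν where
  gamma_nonneg k hk := (h.gamma_nonneg k hk).trans (le_maxUpTo hk γ)
  gamma_lt_one k hk := maxUpTo_lt (by omega) h.gamma_lt_one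
  nu_nonneg k hk := (h.nu_nonneg k hk).trans (le_maxUpTo hk ν)
  integrable_inner := h.integrable_inner
  integrable_opNorm := h.integrable_opNorm
  alignment k hk := by
    filter_upwards [h.alignment k hk] with ω hω
    exact (mul_le_mul_of_nonneg_right (by linarith [le_maxUpTo hk γ])
      (nuclearNorm_nonneg _)).trans hω
  feasibility k hk := by
    filter_upwards [h.feasibility k hk] with ω hω
    exact hω.trans (pow_le_pow_left₀ (by linarith [h.nu_nonneg k hk])
      (by linarith [le_maxUpTo hk ν]) 2)

/-- Resolving the summed descent inequality `h1` and the summed momentum error `h2` for the average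
`mn` of the gradient norms; `S` and `E` are the two sums, `r` stands for `√d₀`. -/
theorem average_le_of_sums {K mn E S Δ η β L s r γ ν q σ₀ σ₁ p bq ρ : ℝ} (hK' : 0 < K)
    (hη : 0 < η) (hb : 0 < 1 - β) (hL : 0 ≤ L) (hν : 0 ≤ ν) (hσ₀ : 0 ≤ σ₀) (hΔ : 0 ≤ Δ)
    (hs : 0 ≤ s) (hr0 : 0 ≤ r) (hp : 0 ≤ p) (hq : 0 ≤ q) (hE : 0 ≤ E) (hbq : 1 ≤ bq)
    (hns : q ≤ 2 / bq) (hρ : 0 < ρ) (hρle : ρ ≤ 1 - γ - (1 + r * (1 + ν)) * (q * (2 * σ₁)))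
    (hmin : K * mn ≤ E)
    (h1 : (1 - γ) * E ≤ Δ / η + (1 + r * (1 + ν)) * S + K * (L * η * (r ^ 2 * (1 + ν) ^ 2)))
    (h2 : S ≤ s / (1 - β) + K * (β ^ 2 * (L * η * (r * (1 + ν))) / (1 - β))
      + q * (K * (σ₀ * (2 * p)) + σ₁ * (2 * E))) :
    mn ≤ 4 * (1 + r) ^ 2 * (Δ / (ρ * η * K) + β ^ 2 * L * (1 + ν) ^ 2 * η / (ρ * (1 - β))
        + (1 + ν) * σ₀ * p / (ρ * bq) + L * η * (1 + ν) ^ 2 / ρ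
        + (1 + ν) * s / (ρ * (1 - β) * K)) := by
  have hr1 : 1 ≤ 4 * (1 + r) ^ 2 := by nlinarith
  have hr2 : r ^ 2 ≤ 4 * (1 + r) ^ 2 := by nlinarith
  set κ := 1 + r * (1 + ν) with hκ
  have hκ0 : 0 ≤ κ := by positivity
  have hκ1 : κ ≤ (1 + r) ^ 2 * (1 + ν) := by rw [hκ]; nlinarith [mul_nonneg hr0 hν]
  have hκ2 : κ * (r * (1 + ν)) ≤ (1 + r) ^ 2 * (1 + ν) ^ 2 := by
    have a1 : κ ≤ (1 + r) * (1 + ν) := by rw [hκ]; nlinarith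
    have a2 : r * (1 + ν) ≤ (1 + r) * (1 + ν) := by nlinarith
    calc κ * (r * (1 + ν)) ≤ ((1 + r) * (1 + ν)) * ((1 + r) * (1 + ν)) :=
          mul_le_mul a1 a2 (by positivity) (by positivity)
      _ = _ := by ring
  have h3 := mul_le_mul_of_nonneg_left h2 hκ0
  have h4 := mul_le_mul_of_nonneg_right hρle hE
  -- everything but the gradient terms
  have h5 : ρ * (K * mn) ≤ Δ / η + κ * (s / (1 - β))
      + K * (κ * (r * (1 + ν)) * (β ^ 2 * (L * η) / (1 - β)))
      + K * (κ * q * (2 * (σ₀ * p))) + K * (L * η * (r ^ 2 * (1 + ν) ^ 2)) := by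
    have h6 := mul_le_mul_of_nonneg_left hmin hρ.le
    have e : K * (β ^ 2 * (L * η * (r * (1 + ν))) / (1 - β))
        = K * ((r * (1 + ν)) * (β ^ 2 * (L * η) / (1 - β))) := by ring
    rw [e] at h3
    linarith
  have g1 : Δ / η ≤ 4 * (1 + r) ^ 2 * (Δ / η) := by
    exact le_mul_of_one_le_left (by positivity) hr1
  have g2 : κ * (s / (1 - β)) ≤ 4 * (1 + r) ^ 2 * ((1 + ν) * s / (1 - β)) := by
    have h6 : 0 ≤ s / (1 - β) := by positivity
    have h7 := mul_le_mul_of_nonneg_right hκ1 h6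
    have h8 : 0 ≤ (1 + r) ^ 2 * (1 + ν) * (s / (1 - β)) := by positivity
    have e : 4 * (1 + r) ^ 2 * ((1 + ν) * s / (1 - β))
      = 4 * ((1 + r) ^ 2 * (1 + ν) * (s / (1 - β))) := by ring
    linarith
  have g3 : κ * (r * (1 + ν)) * (β ^ 2 * (L * η) / (1 - β))
      ≤ 4 * (1 + r) ^ 2 * (β ^ 2 * L * (1 + ν) ^ 2 * η / (1 - β)) := by
    have h6 : 0 ≤ β ^ 2 * (L * η) / (1 - β) := by positivity
    have h7 := mul_le_mul_of_nonneg_right hκ2 h6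
    have h8 : 0 ≤ (1 + r) ^ 2 * (1 + ν) ^ 2 * (β ^ 2 * (L * η) / (1 - β)) := by positivity
    have e : 4 * (1 + r) ^ 2 * (β ^ 2 * L * (1 + ν) ^ 2 * η / (1 - β))
      = 4 * ((1 + r) ^ 2 * (1 + ν) ^ 2 * (β ^ 2 * (L * η) / (1 - β))) := by ring
    linarith
  have g4 : κ * q * (2 * (σ₀ * p)) ≤ 4 * (1 + r) ^ 2 * ((1 + ν) * σ₀ * p / bq) := by
    have h7 := mul_le_mul hκ1 hns (hq) (by positivity)
    have h8 := mul_le_mul_of_nonneg_right h7 (by positivity : 0 ≤ 2 * (σ₀ * p))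
    refine h8.trans (le_of_eq ?_)
    ring
  have g5 : L * η * (r ^ 2 * (1 + ν) ^ 2) ≤ 4 * (1 + r) ^ 2 * (L * η * (1 + ν) ^ 2) := by
    have h6 := mul_le_mul_of_nonneg_right hr2 (by positivity : 0 ≤ L * η * (1 + ν) ^ 2)
    linarith
  have g3' := mul_le_mul_of_nonneg_left g3 hK'.le
  have g4' := mul_le_mul_of_nonneg_left g4 hK'.le
  have g5' := mul_le_mul_of_nonneg_left g5 hK'.le
  have hfin : mn * (ρ * K) ≤ 4 * (1 + r) ^ 2 * (Δ / η + (1 + ν) * s / (1 - β)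
      + K * (β ^ 2 * L * (1 + ν) ^ 2 * η / (1 - β)) + K * ((1 + ν) * σ₀ * p / bq)
      + K * (L * η * (1 + ν) ^ 2)) := by linarith
  refine ((le_div_iff₀ (mul_pos hρ hK')).2 hfin).trans (le_of_eq ?_)
  field_simp
  ring

namespace MuonRun

variable {m n B : ℕ} {Ω Z : Type*} [mΩ : MeasurableSpace Ω] [MeasurableSpace Z]
  {μ : Measure Ω} [IsProbabilityMeasure μ] {ℱ : Filtration ℕ mΩ} {K : ℕ} {f : Mat m n → ℝ}
  {X₀ Cinit : Mat m n} {G : ℕ → Fin B → Ω → Mat m n} {T : ℕ → Mat m n → Z → Mat m n}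
  {ζ : ℕ → Ω → Z} {fstar α σ₀ σ₁ L η β γ ν : ℝ}

/-- The average of the expected gradient norms. The multiplicative noise contributes a multiple of
this average itself, which `ρ` absorbs. -/
theorem minUpTo_le (h : MuonRun μ ℱ K f X₀ Cinit G T ζ fstar α σ₀ σ₁ L η β γ ν) (hK : 1 ≤ K)
    {ρ : ℝ} (hρ : 0 < ρ)
    (hρle : ρ ≤ 1 - γ - (1 + √((min m n : ℕ) : ℝ) * (1 + ν)) * (noiseScale α B * (2 * σ₁))) :
    minUpTo K (fun k => ∫ ω, ‖∇ f (iterate η β X₀ Cinit G T ζ k ω)‖ ∂μ) ≤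
      4 * (1 + √((min m n : ℕ) : ℝ)) ^ 2 * ((f X₀ - fstar) / (ρ * η * K)
        + β ^ 2 * L * (1 + ν) ^ 2 * η / (ρ * (1 - β))
        + (1 + ν) * σ₀ * (1 - β) ^ ((α - 1) / α) / (ρ * (B : ℝ) ^ ((α - 1) / α))
        + L * η * (1 + ν) ^ 2 / ρ
        + (1 + ν) * (∫ ω, ‖initialError β f X₀ Cinit G ω‖ ∂μ) / (ρ * (1 - β) * K)) := by
  have hη := h.step_pos
  have hb : 0 < 1 - β := by linarith [h.beta_lt]
  have hL := h.L_nonneg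
  have hν := h.nu_nonneg
  have hσ₀ := h.sigma0_nonneg
  have hΔ : 0 ≤ f X₀ - fstar := sub_nonneg.2 (h.lower X₀)
  have hK' : (0 : ℝ) < K := by exact_mod_cast hK
  have h1 := h.sum_integral_gradient_le
  have h2 := h.sum_integral_norm_momentumError_le
  have hmin := minUpTo_mul_le (K := K)
    fun k => ∫ ω, ‖∇ f (iterate η β X₀ Cinit G T ζ k ω)‖ ∂μ
  have hbq := one_le_batch_rpow h.one_lt h.batch_pos
  have hns := noiseScale_le h.one_lt h.batch_pos
  have hd₀ : ((min m n : ℕ) : ℝ) = √((min m n : ℕ) : ℝ) ^ 2 :=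
    (Real.sq_sqrt (Nat.cast_nonneg _)).symm
  have hs : 0 ≤ ∫ ω, ‖initialError β f X₀ Cinit G ω‖ ∂μ := integral_nonneg fun _ => norm_nonneg _
  have hE : 0 ≤ ∑ k ∈ Finset.range K, ∫ ω, ‖∇ f (iterate η β X₀ Cinit G T ζ k ω)‖ ∂μ :=
    Finset.sum_nonneg fun _ _ => integral_nonneg fun _ => norm_nonneg _
  rw [hd₀, Real.sqrt_sq (Real.sqrt_nonneg _)] at h1
  exact average_le_of_sums hK' hη hb hL hν hσ₀ hΔ hs (Real.sqrt_nonneg _) (by positivity)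
    (noiseScale_nonneg α B) hE hbq hns hρ hρle hmin h1 h2

theorem integral_norm_initialError_le
    (h : MuonRun μ ℱ K f X₀ Cinit G T ζ fstar α σ₀ σ₁ L η β γ ν) (hK : 1 ≤ K) :
    ∫ ω, ‖initialError β f X₀ Cinit G ω‖ ∂μ
      ≤ 2 * (σ₀ + (1 + σ₁) * ‖∇ f X₀‖ + ‖Cinit‖) := by
  have hβ := h.beta_pos
  have hβ1 := h.beta_lt
  have hσ₀ := h.sigma0_nonneg
  have hσ₁ := h.sigma1_nonneg
  set ξ := batchNoise f (iterate η β X₀ Cinit G T ζ) G 0 with hξ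
  have hξi : Integrable ξ μ := h.noise.integrable_batchNoise h.one_lt h.batch_pos hK
  have hξ' : ∫ ω, ‖ξ ω‖ ∂μ ≤ 2 * (σ₀ + σ₁ * ‖∇ f X₀‖) := by
    have h1 := h.noise.integral_norm_sum_le h.one_lt h.le_two h.batch_pos hσ₀ hσ₁
      h.continuous_gradient.measurable (fun k hk => h.measurable_iterate hk.le) h.adapted.grad
      (fun _ => 1) hK
    simp only [Finset.sum_range_one, one_smul, abs_one, Real.one_rpow, mul_one, one_mul] at h1
    have h2 : ∫ ω, ‖∇ f (iterate η β X₀ Cinit G T ζ 0 ω)‖ ∂μ = ‖∇ f X₀‖ := by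
      simp [iterate]
    rw [h2] at h1
    refine h1.trans (mul_le_mul_of_nonneg_right ?_ (by positivity))
    refine (noiseScale_le h.one_lt h.batch_pos).trans ?_
    exact div_le_self (by norm_num) (one_le_batch_rpow h.one_lt h.batch_pos)
  have hpt : ∀ ω, ‖initialError β f X₀ Cinit G ω‖ ≤ (‖Cinit‖ + ‖∇ f X₀‖) + ‖ξ ω‖ := by
    intro ω
    have e : initialError β f X₀ Cinit G ω = ((1 - β) * β ^ 2) • Cinit
        + (-(β ^ 2)) • ∇ f X₀ + (1 - β ^ 2) • ξ ω := by
      simp only [initialError, nesterov, momentum, hξ, batchNoise, iterate]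
      module
    have hβ2 : β ^ 2 ≤ 1 := by nlinarith
    rw [e]
    refine (norm_add₃_le).trans ?_
    rw [norm_smul, norm_smul, norm_smul, norm_neg, Real.norm_of_nonneg (by positivity),
      Real.norm_of_nonneg (by positivity), Real.norm_of_nonneg (by linarith)]
    have a1 : (1 - β) * β ^ 2 * ‖Cinit‖ ≤ ‖Cinit‖ :=
      mul_le_of_le_one_left (norm_nonneg _) (by nlinarith [sq_nonneg β])
    have a2 : β ^ 2 * ‖∇ f X₀‖ ≤ ‖∇ f X₀‖ := mul_le_of_le_one_left (norm_nonneg _) hβ2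
    have a3 : (1 - β ^ 2) * ‖ξ ω‖ ≤ ‖ξ ω‖ :=
      mul_le_of_le_one_left (norm_nonneg _) (by nlinarith [sq_nonneg β])
    linarith
  have hSi : Integrable (initialError β f X₀ Cinit G) μ := h.integrable_momentumError hK
  have h3 := integral_mono hSi.norm ((integrable_const _).add hξi.norm) hpt
  rw [integral_add' (integrable_const _) hξi.norm, integral_const] at h3
  simp only [probReal_univ, one_smul] at h3
  have := norm_nonneg Cinit
  have := norm_nonneg (∇ f X₀)
  linarith

end MuonRun

/-- With the prescribed step size and momentum all six error terms have the order
`K ^ (-(α - 1) / (3 α - 2))`. -/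
theorem error_terms_le_rate {α : ℝ} (hα : 1 < α) {K : ℕ} (hK : 1 ≤ K)
    {η β ρ Δ L a σ₀ σ₁ s g c b : ℝ} (hρ : 0 < ρ) (hβ0 : 0 < β) (hβ1 : β < 1)
    (hη : η = (K : ℝ) ^ (-((2 * α - 1) / (3 * α - 2))))
    (hβ : β = 1 - (K : ℝ) ^ (-(α / (3 * α - 2)))) (hΔ : 0 ≤ Δ) (hL : 0 ≤ L) (ha : 0 ≤ a)
    (hσ₀ : 0 ≤ σ₀) (hσ₁ : 0 ≤ σ₁) (hg : 0 ≤ g) (hc : 0 ≤ c) (hb : 1 ≤ b) (hs0 : 0 ≤ s)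
    (hs : s ≤ 2 * (σ₀ + (1 + σ₁) * g + c)) :
    Δ / (ρ * η * K) + β ^ 2 * L * a ^ 2 * η / (ρ * (1 - β))
        + a * σ₀ * (1 - β) ^ ((α - 1) / α) / (ρ * b) + L * η * a ^ 2 / ρ
        + a * s / (ρ * (1 - β) * K) + a * σ₁ * g / (ρ * b * K)
      ≤ 4 / ρ * (Δ + a ^ 2 * L + a * (σ₀ + (1 + σ₁) * g + c))
        * (K : ℝ) ^ (-((α - 1) / (3 * α - 2))) := by
  have hK1 : (1 : ℝ) ≤ K := by exact_mod_cast hK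
  have hK0 : (0 : ℝ) < K := by linarith
  have hP : 0 < 3 * α - 2 := by linarith
  have hβ' : 1 - β = (K : ℝ) ^ (-(α / (3 * α - 2))) := by rw [hβ]; ring
  set r := (K : ℝ) ^ (-((α - 1) / (3 * α - 2))) with hr
  have hr0 : 0 < r := Real.rpow_pos_of_pos hK0 _
  have hr1 : r ≤ 1 := Real.rpow_le_one_of_one_le_of_nonpos hK1
    (neg_nonpos.2 (div_nonneg (by linarith) hP.le))
  have hη0 : 0 < η := by rw [hη]; positivity
  have e1 : η * K * r = 1 := by
    have e0 : (2 * α - 1) / (3 * α - 2) + (α - 1) / (3 * α - 2) = 1 := by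
      rw [← add_div, div_eq_one_iff_eq hP.ne']
      ring
    calc η * K * r = η * (K : ℝ) ^ (1 : ℝ) * r := by rw [Real.rpow_one]
      _ = (K : ℝ) ^ (-((2 * α - 1) / (3 * α - 2)) + 1 + -((α - 1) / (3 * α - 2))) := by
        rw [Real.rpow_add hK0, Real.rpow_add hK0, hη]
      _ = 1 := by
        rw [show -((2 * α - 1) / (3 * α - 2)) + 1 + -((α - 1) / (3 * α - 2)) = 0 by linarith,
          Real.rpow_zero]
  have e2 : η = r * (1 - β) := by
    rw [hβ', hη, hr, ← Real.rpow_add hK0]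
    congr 1
    field_simp
    ring
  have e3 : (1 - β) ^ ((α - 1) / α) = r := by
    rw [hβ', hr, ← Real.rpow_mul hK0.le]
    congr 1
    field_simp
  have e4 : (1 - β) * K * (r * r) = 1 := by
    linear_combination e1 - K * r * e2
  have e5 : 1 ≤ K * r := by
    calc (1 : ℝ) ≤ (K : ℝ) ^ (1 + -((α - 1) / (3 * α - 2))) := by
          refine Real.one_le_rpow hK1 ?_
          have : (α - 1) / (3 * α - 2) ≤ 1 := by rw [div_le_one hP]; linarith
          linarith
      _ = K * r := by rw [Real.rpow_add hK0, Real.rpow_one]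
  have hβ2 : β ^ 2 ≤ 1 := by nlinarith
  have t1 : Δ / (ρ * η * K) = Δ * r / ρ := by
    rw [div_eq_div_iff (by positivity) hρ.ne']
    linear_combination (-(Δ * ρ)) * e1
  have t2 : β ^ 2 * L * a ^ 2 * η / (ρ * (1 - β)) ≤ a ^ 2 * L * r / ρ := by
    rw [e2, div_le_div_iff₀ (by positivity) hρ]
    have h1 : 0 ≤ L * a ^ 2 * (r * (1 - β)) * ρ := by positivity
    have h2 := mul_le_mul_of_nonneg_right hβ2 h1
    linarith
  have t3 : a * σ₀ * (1 - β) ^ ((α - 1) / α) / (ρ * b) ≤ a * σ₀ * r / ρ := by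
    rw [e3]
    exact div_le_div_of_nonneg_left (by positivity) hρ (le_mul_of_one_le_right hρ.le hb)
  have t4 : L * η * a ^ 2 / ρ ≤ a ^ 2 * L * r / ρ := by
    refine div_le_div_of_nonneg_right ?_ hρ.le
    have h1 : η ≤ r := by rw [e2]; exact mul_le_of_le_one_right hr0.le (by linarith)
    have h2 := mul_le_mul_of_nonneg_left h1 (by positivity : 0 ≤ L * a ^ 2)
    linarith
  have t5 : a * s / (ρ * (1 - β) * K) ≤ 2 * (a * (σ₀ + (1 + σ₁) * g + c)) * r / ρ := by
    have h1 : a * s / (ρ * (1 - β) * K) = a * s * (r * r) / ρ := by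
      rw [div_eq_div_iff (by positivity) hρ.ne']
      linear_combination (-(a * s * ρ)) * e4
    rw [h1]
    refine div_le_div_of_nonneg_right ?_ hρ.le
    have h2 : a * s * (r * r) ≤ a * s * r :=
      mul_le_mul_of_nonneg_left (mul_le_of_le_one_right hr0.le hr1) (by positivity)
    have h3 := mul_le_mul_of_nonneg_left hs (by positivity : 0 ≤ a * r)
    linarith
  have t6 : a * σ₁ * g / (ρ * b * K) ≤ a * (σ₁ * g) * r / ρ := by
    rw [div_le_div_iff₀ (by positivity) hρ]
    have h1 : 1 ≤ b * (K * r) := one_le_mul_of_one_le_of_one_le hb e5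
    have h2 := mul_le_mul_of_nonneg_left h1 (by positivity : 0 ≤ a * σ₁ * g * ρ)
    linarith
  have hq : a * σ₀ * r / ρ + a * (σ₁ * g) * r / ρ
      ≤ 2 * (a * (σ₀ + (1 + σ₁) * g + c)) * r / ρ := by
    rw [← add_div]
    refine div_le_div_of_nonneg_right ?_ hρ.le
    have h1 : 0 ≤ a * r * (σ₀ + σ₁ * g + 2 * g + 2 * c) := by positivity
    linarith
  have hΔr : 0 ≤ Δ * r / ρ := by positivity
  have hLr : 0 ≤ a ^ 2 * L * r / ρ := by positivity
  have e : 4 / ρ * (Δ + a ^ 2 * L + a * (σ₀ + (1 + σ₁) * g + c)) * r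
      = 4 * (Δ * r / ρ) + 4 * (a ^ 2 * L * r / ρ)
        + 2 * (2 * (a * (σ₀ + (1 + σ₁) * g + c)) * r / ρ) := by ring
  rw [e, t1]
  linarith

end Muon

theorem theorem2 (α : ℝ) (hα₁ : 1 < α) (hα₂ : α ≤ 2) :
    ∃ Cα : ℝ, 0 < Cα ∧ Cα ≤ 2 ∧ ∀ d₀ : ℕ, ∃ A : ℝ, 0 < A ∧
      ∀ (m n : ℕ), min m n = d₀ →
      ∀ (Ω Z : Type*) [mΩ : MeasurableSpace Ω] [MeasurableSpace Z]
        (μ : Measure Ω) [IsProbabilityMeasure μ] (ℱ : Filtration ℕ mΩ)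
        (f : Muon.Mat m n → ℝ) (fstar L σ₀ σ₁ η β : ℝ) (γ ν : ℕ → ℝ) (K B : ℕ)
        (X₀ Cinit : Muon.Mat m n) (G : ℕ → Fin B → Ω → Muon.Mat m n)
        (T : ℕ → Muon.Mat m n → Z → Muon.Mat m n) (ζ : ℕ → Ω → Z),
      1 ≤ K → 0 < η → 0 < β → β < 1 → 0 ≤ L → 0 ≤ σ₀ → 0 ≤ σ₁ →
      (∀ X, fstar ≤ f X) →
      Muon.LSmooth f L →
      Muon.Adapted ℱ K G ζ →
      (∀ k < K, Measurable (Function.uncurry (T k))) →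
      Muon.FreshSeeds μ ℱ K G ζ →
      Muon.HeavyTailedNoise μ ℱ K f (Muon.iterate η β X₀ Cinit G T ζ) G α σ₀ σ₁ →
      Muon.InexactPolar μ K (Muon.nesterov β Cinit G) (Muon.polarStep β Cinit G T ζ) γ ν →
      Muon.batchThreshold α Cα d₀ σ₁ (Muon.maxUpTo K γ) (Muon.maxUpTo K ν) < (B : ℝ) →
      let νbar := Muon.maxUpTo K ν
      let ρ := Muon.rho α Cα d₀ σ₁ (Muon.maxUpTo K γ) νbar B
      let X := Muon.iterate η β X₀ Cinit G T ζ
      let S₀ := Muon.initialError β f X₀ Cinit G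
      0 < ρ ∧
      (∀ k < K, Integrable (fun ω => ‖∇ f (X k ω)‖) μ) ∧
      Integrable (fun ω => ‖S₀ ω‖) μ ∧
      Muon.minUpTo K (fun k => ∫ ω, ‖∇ f (X k ω)‖ ∂μ) ≤
        A * ((f X₀ - fstar) / (ρ * η * K)
          + β ^ 2 * L * (1 + νbar) ^ 2 * η / (ρ * (1 - β))
          + (1 + νbar) * σ₀ * (1 - β) ^ ((α - 1) / α) / (ρ * (B : ℝ) ^ ((α - 1) / α))
          + L * η * (1 + νbar) ^ 2 / ρ
          + (1 + νbar) * (∫ ω, ‖S₀ ω‖ ∂μ) / (ρ * (1 - β) * K)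
          + (1 + νbar) * σ₁ * ‖∇ f X₀‖ / (ρ * (B : ℝ) ^ ((α - 1) / α) * K)) ∧
      (2 ≤ K → η = (K : ℝ) ^ (-((2 * α - 1) / (3 * α - 2))) →
        β = 1 - (K : ℝ) ^ (-(α / (3 * α - 2))) →
        Muon.minUpTo K (fun k => ∫ ω, ‖∇ f (X k ω)‖ ∂μ) ≤
          A / ρ * (f X₀ - fstar + (1 + νbar) ^ 2 * L
            + (1 + νbar) * (σ₀ + (1 + σ₁) * ‖∇ f X₀‖ + ‖Cinit‖))
            * (K : ℝ) ^ (-((α - 1) / (3 * α - 2)))) := by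
  refine ⟨2, by norm_num, le_rfl, fun d₀ => ⟨16 * (1 + √(d₀ : ℝ)) ^ 2, by positivity, ?_⟩⟩
  intro m n hd₀ Ω Z mΩ _ μ _ ℱ f fstar L σ₀ σ₁ η β γ ν K B X₀ Cinit G T ζ hK hη hβ0 hβ1 hL hσ₀ hσ₁
    hlower hsmooth hadapted hT hfresh hnoise hpolar hB νbar ρ X S₀
  subst hd₀
  have hpolar' := hpolar.maxUpTo
  have hγlt := hpolar'.gamma_lt_one 0 hK
  have hν := hpolar'.nu_nonneg 0 hK
  have hBpos : 0 < B := by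
    have h0 : (0 : ℝ) ≤ Muon.batchThreshold α 2 (min m n) σ₁ (Muon.maxUpTo K γ)
        (Muon.maxUpTo K ν) := by
      have : 0 < 1 - Muon.maxUpTo K γ := sub_pos.2 hγlt
      have : 0 ≤ Muon.maxUpTo K ν := hν
      unfold Muon.batchThreshold
      positivity
    exact_mod_cast h0.trans_lt hB
  have hrun : Muon.MuonRun μ ℱ K f X₀ Cinit G T ζ fstar α σ₀ σ₁ L η β (Muon.maxUpTo K γ) νbar :=
    { one_lt := hα₁, le_two := hα₂, batch_pos := hBpos, step_pos := hη, beta_pos := hβ0,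
      beta_lt := hβ1, L_nonneg := hL, sigma0_nonneg := hσ₀, sigma1_nonneg := hσ₁,
      gamma_nonneg := hpolar'.gamma_nonneg 0 hK, gamma_lt := hγlt, nu_nonneg := hν,
      lower := hlower, smooth := hsmooth, adapted := hadapted, measurable_routine := hT,
      fresh := hfresh, noise := hnoise, polar := hpolar' }
  have hρ : 0 < ρ := Muon.rho_pos hα₁ (by norm_num) hσ₁ hγlt hν hB
  have hΔ : 0 ≤ f X₀ - fstar := sub_nonneg.2 (hlower X₀)
  have hbq := Muon.one_le_batch_rpow hα₁ hBpos
  have hs0 : 0 ≤ ∫ ω, ‖S₀ ω‖ ∂μ := integral_nonneg fun _ => norm_nonneg _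
  -- the noise enters with the constant `2 * 2 ^ (1 / α)`, which `2 √π * 2 ^ (1 / α)` dominates
  have hρle : ρ ≤ 1 - Muon.maxUpTo K γ - (1 + √((min m n : ℕ) : ℝ) * (1 + νbar))
      * (Muon.noiseScale α B * (2 * σ₁)) := by
    have hπ : 1 ≤ √Real.pi := Real.one_le_sqrt.2 (by linarith [Real.pi_gt_three])
    have h1 : 0 ≤ (1 + √((min m n : ℕ) : ℝ) * (1 + νbar)) * 2 * 2 ^ (1 / α) * σ₁
        / (B : ℝ) ^ ((α - 1) / α) := by positivity
    have h2 := mul_le_mul_of_nonneg_left hπ h1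
    rw [Muon.noiseScale_eq α hBpos]
    change 1 - Muon.maxUpTo K γ - (1 + √((min m n : ℕ) : ℝ) * (1 + νbar)) * (2 * √Real.pi)
      * 2 ^ (1 / α) * σ₁ / (B : ℝ) ^ ((α - 1) / α) ≤ _
    have e1 : (1 + √((min m n : ℕ) : ℝ) * (1 + νbar)) * (2 * √Real.pi) * 2 ^ (1 / α) * σ₁
        / (B : ℝ) ^ ((α - 1) / α) = (1 + √((min m n : ℕ) : ℝ) * (1 + νbar)) * 2 * 2 ^ (1 / α) * σ₁
        / (B : ℝ) ^ ((α - 1) / α) * √Real.pi := by ring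
    have e2 : (1 + √((min m n : ℕ) : ℝ) * (1 + νbar))
        * (2 ^ (1 / α) / (B : ℝ) ^ ((α - 1) / α) * (2 * σ₁))
        = (1 + √((min m n : ℕ) : ℝ) * (1 + νbar)) * 2 * 2 ^ (1 / α) * σ₁
        / (B : ℝ) ^ ((α - 1) / α) * 1 := by ring
    rw [e1, e2]
    linarith
  have hmain := hrun.minUpTo_le hK hρ hρle
  have hlast : 0 ≤ (1 + νbar) * σ₁ * ‖∇ f X₀‖ / (ρ * (B : ℝ) ^ ((α - 1) / α) * K) := by
    positivity
  have hmain' : Muon.minUpTo K (fun k => ∫ ω, ‖∇ f (X k ω)‖ ∂μ) ≤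
      4 * (1 + √((min m n : ℕ) : ℝ)) ^ 2 * ((f X₀ - fstar) / (ρ * η * K)
          + β ^ 2 * L * (1 + νbar) ^ 2 * η / (ρ * (1 - β))
          + (1 + νbar) * σ₀ * (1 - β) ^ ((α - 1) / α) / (ρ * (B : ℝ) ^ ((α - 1) / α))
          + L * η * (1 + νbar) ^ 2 / ρ
          + (1 + νbar) * (∫ ω, ‖S₀ ω‖ ∂μ) / (ρ * (1 - β) * K)
          + (1 + νbar) * σ₁ * ‖∇ f X₀‖ / (ρ * (B : ℝ) ^ ((α - 1) / α) * K)) :=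
    hmain.trans (mul_le_mul_of_nonneg_left (by linarith) (by positivity))
  refine ⟨hρ, fun k hk => (hrun.integrable_gradient hk).norm,
    (hrun.integrable_momentumError hK).norm, hmain'.trans ?_, fun _ hη' hβ' => hmain'.trans ?_⟩
  · refine mul_le_mul_of_nonneg_right ?_ (by positivity)
    have : 0 ≤ (1 + √((min m n : ℕ) : ℝ)) ^ 2 := by positivity
    linarith
  · have hrate := Muon.error_terms_le_rate hα₁ hK hρ hβ0 hβ1 hη' hβ' hΔ hL
      (by linarith : 0 ≤ 1 + νbar) hσ₀ hσ₁ (norm_nonneg (∇ f X₀)) (norm_nonneg Cinit) hbq hs0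
      (hrun.integral_norm_initialError_le hK)
    refine (mul_le_mul_of_nonneg_left hrate (by positivity)).trans (le_of_eq ?_)
    ring
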